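/- Graphs are finite and may have loops and parallel edges. All embeddings are cellular embeddings of connected graphs into closed orientable surfaces. A connected graph is *2-connected* if it has no cutvertex; here a vertex that carries a loop and is incident with a further edge counts as a cutvertex. A connected graph is *upper-embeddable* if it has an embedding with at most two faces, and *two-face-embeddable* if it has an embedding with exactly two faces. A pair $\{x,y\}$ of distinct vertices of a graph $G$ is *removable* if $x$ and $y$ are joined by exactly one edge, this edge is not a bridge, and $G-\{x,y\}$ is (connected and) upper-embeddable. A two-face-embeddable cubic graph is *amply two-face-embeddable* if it has a removable pair of vertices, and *tightly two-face-embeddable* otherwise. For a connected graph $G$ let $\beta(G)=|E(G)|-|V(G)|+1$, let $\gamma_M(G)$ be the largest genus of a closed orientable surface into which $G$ has a cellular embedding, and let $\xi(G)=\beta(G)-2\gamma_M(G)$. A *Xuong tree* of $G$ is a spanning tree $T$ such that exactly $\xi(G)$ components of $G-E(T)$ have an odd number of edges. An edge $e$ of a tightly two-face-embeddable cubic graph $G$ is *odd* if $G$ has a Xuong tree $T$ such that $G-E(T)$ has exactly one component with an odd number of edges, and $e$ is the only edge of that component. Let $G_1$ and $G_2$ be disjoint tightly two-face-embeddable cubic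 graphs, and let $e_i=a_ib_i$, with $a_i\ne b_i$, be an odd edge of $G_i$ for $i\in\{1,2\}$, the two ends of each edge being labelled in either order. The graph $G$ obtained from $(G_1-e_1)\cup(G_2-e_2)$ by adding two new edges, $f_1$ joining $a_1$ to $a_2$ and $f_2$ joining $b_1$ to $b_2$, is called an *odd $2$-sum* of $G_1$ and $G_2$ with respect to $e_1$ and $e_2$. **Theorem.** If $G_1$ and $G_2$ are $2$-connected tightly two-face-embeddable cubic graphs and $G$ is an odd $2$-sum of $G_1$ and $G_2$ with respect to odd edges $e_1$ of $G_1$ and $e_2$ of $G_2$, then $G$ is a $2$-connected tightly two-face-embeddable cubic graph. -/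

import Mathlib

namespace Graph

universe u v

/-! Multigraphs (loops and parallel edges allowed) are Mathlib's `Graph α β`. -/

/-- Both the vertex set and the edge set are finite. -/
def IsFinite {α : Type u} {β : Type v} (G : Graph α β) : Prop :=
  V(G).Finite ∧ E(G).Finite

/-- `y` can be reached from `x` along edges of `G`. -/
def Reachable {α : Type u} {β : Type v} (G : Graph α β) (x y : α) : Prop :=
  Relation.ReflTransGen G.Adj x y

/-- A graph is connected if it has a vertex and any two of its vertices are joined by a walk. -/
def IsConnected {α : Type u} {β : Type v} (G : Graph α β) : Prop :=
  V(G).Nonempty ∧ ∀ x ∈ V(G), ∀ y ∈ V(G), G.Reachable x y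

/-- The valency of a vertex; a loop contributes two. -/
noncomputable def valency {α : Type u} {β : Type v} (G : Graph α β) (x : α) : ℕ :=
  (G.incidenceSet x).ncard + (G.loopSet x).ncard

/-- Finite cubic graphs. -/
def IsCubic {α : Type u} {β : Type v} (G : Graph α β) : Prop :=
  G.IsFinite ∧ ∀ x ∈ V(G), G.valency x = 3

/-- A bridge: an edge whose ends are not joined by a walk once the edge has been deleted. -/
def IsBridge {α : Type u} {β : Type v} (G : Graph α β) (e : β) : Prop :=
  ∃ x y, G.IsLink e x y ∧ ¬ (G.deleteEdges {e}).Reachable x y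

/-- Cutvertices of a connected graph, in the sense of topological graph theory: the removal of the
point `v` disconnects the graph regarded as a 1-dimensional cell complex. This happens if two of
the remaining vertices get separated, or if `v` carries a loop (whose interior is then cut off)
together with a further edge. -/
def IsCutvertex {α : Type u} {β : Type v} (G : Graph α β) (v : α) : Prop :=
  v ∈ V(G) ∧
    ((∃ x ∈ V(G), ∃ y ∈ V(G), x ≠ v ∧ y ≠ v ∧ ¬ (G.deleteVerts {v}).Reachable x y) ∨
      (∃ e f, G.IsLoopAt e v ∧ G.Inc f v ∧ f ≠ e))

/-- `2`-connected graphs: connected, without cutvertices. -/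
def IsTwoConnected {α : Type u} {β : Type v} (G : Graph α β) : Prop :=
  G.IsConnected ∧ ∀ v, ¬ G.IsCutvertex v

/-! ### Cellular embeddings into closed orientable surfaces -/

/-- A dart is an edge together with one of its two directions (also when the edge is a loop). -/
abbrev Dart {α : Type u} {β : Type v} (G : Graph α β) : Type v := E(G) × Bool

/-- The reversal of darts. -/
def dartRev {α : Type u} {β : Type v} (G : Graph α β) : Equiv.Perm G.Dart :=
  (Equiv.refl E(G)).prodCongr Equiv.boolNot

/-- A rotation system of a graph: the combinatorial form of a cellular embedding into a closed
oriented surface. `org d` is the initial vertex of the dart `d`, and `rot` permutes the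
darts issuing from each vertex cyclically. -/
structure RotationSystem {α : Type u} {β : Type v} (G : Graph α β) where
  org : G.Dart → α
  isLink : ∀ e : E(G), G.IsLink e (org (e, false)) (org (e, true))
  rot : Equiv.Perm G.Dart
  sameCycle_iff : ∀ d d', rot.SameCycle d d' ↔ org d = org d'

/-- The face-tracing permutation: traverse a dart, then turn to the next dart at its end. -/
def RotationSystem.facePerm {α : Type u} {β : Type v} {G : Graph α β} (R : G.RotationSystem) :
    Equiv.Perm G.Dart :=
  (G.dartRev).trans R.rot

/-- The number of faces: the cycles of the face-tracing permutation, and one face for every vertex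
without edges (a single vertex is embedded into the sphere with one face). -/
noncomputable def RotationSystem.faceCount {α : Type u} {β : Type v} {G : Graph α β}
    (R : G.RotationSystem) : ℕ :=
  Nat.card (Quotient (Equiv.Perm.SameCycle.setoid R.facePerm)) +
    {x | x ∈ V(G) ∧ ∀ e, ¬ G.Inc e x}.ncard

/-- The genus `g` of the embedding of a connected graph, from the Euler–Poincaré equation
`n - m + r = 2 - 2 * g`. -/
noncomputable def RotationSystem.genus {α : Type u} {β : Type v} {G : Graph α β}
    (R : G.RotationSystem) : ℤ :=
  (2 - V(G).ncard + E(G).ncard - R.faceCount) / 2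

/-- The maximum orientable genus of a finite connected graph. -/
noncomputable def maxGenus {α : Type u} {β : Type v} (G : Graph α β) : ℤ :=
  sSup (Set.range fun R : G.RotationSystem => R.genus)

/-- The Betti number (cycle rank) of a connected graph. -/
noncomputable def betti {α : Type u} {β : Type v} (G : Graph α β) : ℤ :=
  E(G).ncard - V(G).ncard + 1

/-- The deficiency of a connected graph. -/
noncomputable def deficiency {α : Type u} {β : Type v} (G : Graph α β) : ℤ :=
  G.betti - 2 * G.maxGenus

/-- Upper-embeddable graphs: connected, with a cellular embedding into a closed orientable surface
with at most two faces. -/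
def IsUpperEmbeddable {α : Type u} {β : Type v} (G : Graph α β) : Prop :=
  G.IsConnected ∧ ∃ R : G.RotationSystem, R.faceCount ≤ 2

/-- (Orientably) two-face-embeddable graphs. -/
def IsTwoFaceEmbeddable {α : Type u} {β : Type v} (G : Graph α β) : Prop :=
  G.IsConnected ∧ ∃ R : G.RotationSystem, R.faceCount = 2

/-! ### Ample and tight embeddability -/

/-- A removable pair: `x` and `y` are distinct, joined by exactly one edge, this edge is not a
bridge, and the deletion of `x` and `y` leaves an upper-embeddable graph. -/
def IsRemovablePair {α : Type u} {β : Type v} (G : Graph α β) (x y : α) : Prop :=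
  x ≠ y ∧ (∃ e, (∀ f, G.IsLink f x y ↔ f = e) ∧ ¬ G.IsBridge e) ∧
    (G.deleteVerts {x, y}).IsUpperEmbeddable

/-- Amply two-face-embeddable cubic graphs. -/
def IsAmplyTwoFaceEmbeddable {α : Type u} {β : Type v} (G : Graph α β) : Prop :=
  G.IsCubic ∧ G.IsTwoFaceEmbeddable ∧ ∃ x y, G.IsRemovablePair x y

/-- Tightly two-face-embeddable cubic graphs. -/
def IsTightlyTwoFaceEmbeddable {α : Type u} {β : Type v} (G : Graph α β) : Prop :=
  G.IsCubic ∧ G.IsTwoFaceEmbeddable ∧ ¬ G.IsAmplyTwoFaceEmbeddable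

/-! ### Xuong trees and odd edges -/

/-- A tree: a connected graph each of whose edges is a bridge (that is, without cycles). -/
def IsTree {α : Type u} {β : Type v} (T : Graph α β) : Prop :=
  T.IsConnected ∧ ∀ e ∈ E(T), T.IsBridge e

/-- `T` is a spanning tree of `G`. -/
def IsSpanningTree {α : Type u} {β : Type v} (T G : Graph α β) : Prop :=
  T ≤s G ∧ T.IsTree

/-- The cotree of `T` in `G`: the spanning subgraph `G - E(T)`. -/
def cotree {α : Type u} {β : Type v} (G T : Graph α β) : Graph α β :=
  G.deleteEdges E(T)

/-- The set of edges of the component of `H` that contains the vertex `x`. -/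
def componentEdges {α : Type u} {β : Type v} (H : Graph α β) (x : α) : Set β :=
  {e | ∃ y, H.Reachable x y ∧ H.Inc e y}

/-- The odd components of `H`, i.e. those with an odd number of edges, each given by its edge set
(which is not empty, hence determines the component). -/
def oddComponents {α : Type u} {β : Type v} (H : Graph α β) : Set (Set β) :=
  {F | ∃ x ∈ V(H), F = H.componentEdges x ∧ Odd F.ncard}

/-- A Xuong tree of `G`: a spanning tree whose cotree has exactly `ξ(G)` odd components, where
`ξ(G)` is the deficiency of `G`. -/
def IsXuongTree {α : Type u} {β : Type v} (G T : Graph α β) : Prop :=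
  T.IsSpanningTree G ∧ ((G.cotree T).oddComponents.ncard : ℤ) = G.deficiency

/-- An odd edge: an edge that by itself constitutes the unique odd component of the cotree of some
Xuong tree. -/
def IsOddEdge {α : Type u} {β : Type v} (G : Graph α β) (e : β) : Prop :=
  ∃ T, G.IsXuongTree T ∧ (G.cotree T).oddComponents = {{e}}

/-! ### Odd 2-sums -/

/-- `G` arises from disjoint graphs `G₁` and `G₂` by deleting an edge `e₁` with ends `a₁ ≠ b₁` from
`G₁` and an edge `e₂` with ends `a₂ ≠ b₂` from `G₂`, and adding two new edges, `f₁` between `a₁`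
and `a₂`, and `f₂` between `b₁` and `b₂`. -/
def IsTwoSum {α : Type u} {β : Type v} (G G₁ G₂ : Graph α β) (e₁ e₂ : β) : Prop :=
  Disjoint V(G₁) V(G₂) ∧ Disjoint E(G₁) E(G₂) ∧
    ∃ (f₁ f₂ : β) (a₁ b₁ a₂ b₂ : α),
      f₁ ≠ f₂ ∧ f₁ ∉ E(G₁) ∪ E(G₂) ∧ f₂ ∉ E(G₁) ∪ E(G₂) ∧
      G₁.IsLink e₁ a₁ b₁ ∧ a₁ ≠ b₁ ∧ G₂.IsLink e₂ a₂ b₂ ∧ a₂ ≠ b₂ ∧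
      V(G) = V(G₁) ∪ V(G₂) ∧
      ∀ e x y, G.IsLink e x y ↔
        (G₁.deleteEdges {e₁}).IsLink e x y ∨ (G₂.deleteEdges {e₂}).IsLink e x y ∨
          (e = f₁ ∧ s(x, y) = s(a₁, a₂)) ∨ (e = f₂ ∧ s(x, y) = s(b₁, b₂))

/-- `G` is an odd `2`-sum of `G₁` and `G₂` with respect to their odd edges `e₁` and `e₂`. -/
def IsOddTwoSum {α : Type u} {β : Type v} (G G₁ G₂ : Graph α β) (e₁ e₂ : β) : Prop :=
  G₁.IsOddEdge e₁ ∧ G₂.IsOddEdge e₂ ∧ IsTwoSum G G₁ G₂ e₁ e₂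

end Graph

/-! The faces of an embedding are the cycles of a permutation of the darts, so they can be counted
by signs and changed by transpositions. Comparing signs in "face permutation = rotation times
reversal" shows that the number of faces has the parity of |V| + |E| (`even_faceCount_add`). Each Gᵢ
has a two-face embedding, so |V| + |E| is even for G₁ and G₂, and hence for G.

Existence of a two-face embedding. Let Tᵢ be a Xuong tree of Gᵢ whose cotree has {eᵢ} as its only
odd component. The cotree edges other than eᵢ can be oriented with even in-degrees
(`exists_even_orientation`), hence grouped into pairs with a common head. The tree T₁ + f₁ + T₂
spans G and has one face. A pair of adjacent edges can be added to a one-face embedding without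
losing this property (`insert_pair`): the first edge splits the face into two, both of which visit
the common vertex, and the second edge merges them again if it starts in a corner of the face not
met at its other end. Only f₂ is left unpaired, and it yields two faces. To make corners available
at every vertex, even before it has an edge, each vertex carries a marker, a half-edge fixed by the
reversal; the markers are removed at the end.

Tightness. Deleting a removable pair costs 2 vertices and 5 edges, so by parity what remains of G
has a one-face embedding. Suppose the pair lies in G₁. If it avoids a₁ and b₁, the other side is
replaced by e₁, and each resulting face passes along e₁, so there are at most two faces
(`exists_rotationSystem_left`). If it contains exactly one of a₁ and b₁, the remaining new edge is a
bridge, and cutting off the other side leaves one face (`exists_rotationSystem_left_of_bridge`).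
Either way the pair would be removable in G₁. The pair a₁, b₁ itself separates G. Finally, if the
pair consists of the ends of f₁, the bridge argument gives a one-face embedding of G₁ − a₁; but
there |V| + |E| is even, a contradiction. The remaining cases are symmetric. -/

namespace Equiv.Perm

/-! ### First-return permutations -/

/-- The first-return permutation of `σ` along an injection `f`. -/
theorem exists_firstReturn {X Y : Type*} [Finite Y] (σ : Perm Y) (f : X → Y)
    (hf : Function.Injective f) :
    ∃ τ : Perm X, (∀ a b, τ.SameCycle a b ↔ σ.SameCycle (f a) (f b)) ∧
      ∀ (a b : X) (n : ℕ), (σ ^ (n + 1)) (f a) = f b →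
        (∀ k < n, (σ ^ (k + 1)) (f a) ∉ Set.range f) → τ a = b := by
  classical
  have : Finite X := Finite.of_injective f hf
  have hex : ∀ a, ∃ n, (σ ^ (n + 1)) (f a) ∈ Set.range f := fun a => by
    -- Times are written as n + 1 so that a return takes at least one step; after `orderOf σ` steps
    -- the orbit is back at f a itself.
    refine ⟨orderOf σ - 1, ?_⟩
    rw [Nat.sub_add_cancel (orderOf_pos σ), pow_orderOf_eq_one]
    exact ⟨a, rfl⟩
  choose g hg using fun a => Nat.find_spec (hex a)
  have hmin : ∀ a b n, (σ ^ (n + 1)) (f a) = f b →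
      (∀ k < n, (σ ^ (k + 1)) (f a) ∉ Set.range f) → n = Nat.find (hex a) ∧ g a = b := by
    intro a b n h1 h2
    have hn : n = Nat.find (hex a) := by
      rw [eq_comm, Nat.find_eq_iff]
      exact ⟨⟨b, h1.symm⟩, h2⟩
    refine ⟨hn, hf ?_⟩
    rw [hg, ← h1, hn]
  have hlt : ∀ a, ∀ k < Nat.find (hex a), (σ ^ (k + 1)) (f a) ∉ Set.range f :=
    fun a k hk => Nat.find_min (hex a) hk
  have hinj : Function.Injective g := by
    -- If two points return to the same place, cancelling the shorter time leaves f a on the forward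
    -- orbit of f a'. Unless no time is left over, that is a return of a' earlier than its first
    -- one.
    have key : ∀ a a', g a = g a' → Nat.find (hex a) ≤ Nat.find (hex a') → a = a' := by
      intro a a' h hle
      have h1 : (σ ^ (Nat.find (hex a) + 1)) (f a) = (σ ^ (Nat.find (hex a') + 1)) (f a') := by
        rw [← hg, ← hg, h]
      obtain ⟨m, hm⟩ := Nat.exists_eq_add_of_le hle
      rw [hm, show Nat.find (hex a) + m + 1 = (Nat.find (hex a) + 1) + m by ring,
        pow_add σ (Nat.find (hex a) + 1), Perm.mul_apply] at h1
      have h2 := (σ ^ (Nat.find (hex a) + 1)).injective h1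
      rcases m with _ | m
      · exact hf (by simpa using h2)
      · exact absurd ⟨a, h2⟩ (hlt a' m (by omega))
    intro a a' h
    rcases le_total (Nat.find (hex a)) (Nat.find (hex a')) with hle | hle
    · exact key a a' h hle
    · exact (key a' a h.symm hle).symm
  refine ⟨Equiv.ofBijective g (Finite.injective_iff_bijective.1 hinj), ?_, ?_⟩
  · set τ := Equiv.ofBijective g (Finite.injective_iff_bijective.1 hinj)
    have hτ : ∀ a, τ a = g a := fun a => rfl
    have hstep : ∀ a, σ.SameCycle (f a) (f (τ a)) := fun a => by
      rw [hτ, hg]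
      exact sameCycle_pow_right.2 (SameCycle.refl _ _)
    intro a b
    constructor
    · intro h
      obtain ⟨n, rfl⟩ := h.exists_nat_pow_eq
      clear h
      induction n with
      | zero => exact SameCycle.refl _ _
      | succ n ih =>
        rw [pow_succ', Perm.mul_apply]
        exact ih.trans (hstep _)
    · intro h
      obtain ⟨n, hn⟩ := h.exists_nat_pow_eq
      clear h
      induction n using Nat.strong_induction_on generalizing a with
      | _ n ih =>
        rcases n with _ | n
        · rw [hf (by simpa using hn : f a = f b)]
        · have hle : Nat.find (hex a) ≤ n := Nat.find_min' _ ⟨b, hn.symm⟩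
          obtain ⟨m, hm⟩ := Nat.exists_eq_add_of_le hle
          have : (σ ^ m) (f (τ a)) = f b := by
            rw [hτ, hg, ← hn, ← Perm.mul_apply, ← pow_add]
            congr 2
            omega
          exact (sameCycle_apply_left.1 (ih m (by omega) (τ a) this))
  · intro a b n h1 h2
    exact (hmin a b n h1 h2).2

/-! ### Cycles after multiplication by a transposition; signs -/

variable {D : Type*}

/-- A relation that holds between each point and its image contains the cycle relation. -/
theorem SameCycle.of_step {φ : Perm D} {r : D → D → Prop} (hr : Equivalence r)
    (hstep : ∀ a, r a (φ a)) {a b : D} (h : φ.SameCycle a b) : r a b := by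
  obtain ⟨n, rfl⟩ := h
  induction n with
  | zero => exact hr.refl _
  | succ n ih =>
    rw [add_comm, zpow_add, Perm.mul_apply, zpow_one]
    exact hr.trans ih (hstep _)
  | pred n ih =>
    rw [sub_eq_neg_add, zpow_add, Perm.mul_apply, zpow_neg_one]
    refine hr.trans ih (hr.symm ?_)
    have := hstep (φ⁻¹ ((φ ^ (-n : ℤ)) a))
    simpa using this

/-- Being in the same class of `φ`, or both in the union of the classes of `p` and `q`. -/
theorem equivalence_join (φ : Perm D) (p q : D) : Equivalence fun a b => φ.SameCycle a b ∨
    ((φ.SameCycle a p ∨ φ.SameCycle a q) ∧ (φ.SameCycle b p ∨ φ.SameCycle b q)) where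
  refl a := Or.inl (SameCycle.refl _ _)
  symm h := by
    rcases h with h | ⟨h1, h2⟩
    · exact Or.inl h.symm
    · exact Or.inr ⟨h2, h1⟩
  trans {a b c} h h' := by
    rcases h with h | ⟨h1, h2⟩
    · rcases h' with h' | ⟨h3, h4⟩
      · exact Or.inl (h.trans h')
      · exact Or.inr ⟨h3.imp h.trans h.trans, h4⟩
    · rcases h' with h' | ⟨h3, h4⟩
      · exact Or.inr ⟨h1, h2.imp h'.symm.trans h'.symm.trans⟩
      · exact Or.inr ⟨h1, h4⟩

variable [DecidableEq D]

/-- The two permutations differ only in that the images of p and q are exchanged, so each step of φ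
either is a step of the product or leads from the class of one of p, q to that of the other. Nothing
is assumed about p and q; applied to the product itself, this gives the converse comparison. -/
theorem SameCycle.mul_swap {φ : Perm D} (p q : D) {a b : D} (h : φ.SameCycle a b) :
    (φ * swap p q).SameCycle a b ∨
    (((φ * swap p q).SameCycle a p ∨ (φ * swap p q).SameCycle a q) ∧
      ((φ * swap p q).SameCycle b p ∨ (φ * swap p q).SameCycle b q)) := by
  refine SameCycle.of_step (equivalence_join _ p q) (fun a => ?_) h
  set ψ := φ * swap p q with hψ
  by_cases hp : a = p
  · subst hp
    have : φ a = ψ q := by simp [hψ]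
    exact Or.inr ⟨Or.inl (SameCycle.refl _ _), Or.inr (this ▸ (sameCycle_apply_left.2 (SameCycle.refl _ _)))⟩
  by_cases hq : a = q
  · subst hq
    have : φ a = ψ p := by simp [hψ]
    exact Or.inr ⟨Or.inr (SameCycle.refl _ _), Or.inl (this ▸ (sameCycle_apply_left.2 (SameCycle.refl _ _)))⟩
  · have : φ a = ψ a := by simp [hψ, swap_apply_of_ne_of_ne hp hq]
    exact Or.inl (this ▸ sameCycle_apply_right.2 (SameCycle.refl _ _))

/-- The product sends p to φ q and then follows the φ-cycle of q, which by hypothesis never meets p,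
until that cycle closes at q. -/
theorem sameCycle_mul_swap_self [Finite D] {φ : Perm D} {p q : D} (h : ¬ φ.SameCycle p q) :
    (φ * swap p q).SameCycle p q := by
  set ψ := φ * swap p q with hψ
  have key : ∀ n, (φ ^ (n + 1)) q = q ∨ ψ.SameCycle p ((φ ^ (n + 1)) q) ∨ ψ.SameCycle p q := by
    intro n
    induction n with
    | zero =>
      right; left
      have : (φ ^ (0 + 1)) q = ψ p := by simp [hψ]
      rw [this]
      exact sameCycle_apply_right.2 (SameCycle.refl _ _)
    | succ n ih =>
      by_cases h0 : (φ ^ (n + 1)) q = q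
      · right; left
        have : (φ ^ (n + 1 + 1)) q = ψ p := by
          rw [pow_succ', Perm.mul_apply, h0]; simp [hψ]
        rw [this]
        exact sameCycle_apply_right.2 (SameCycle.refl _ _)
      · rcases ih with ih | ih | ih
        · exact absurd ih h0
        · right; left
          have hp : (φ ^ (n + 1)) q ≠ p := fun e =>
            h (e ▸ (sameCycle_pow_left.2 (SameCycle.refl _ _)))
          have : (φ ^ (n + 1 + 1)) q = ψ ((φ ^ (n + 1)) q) := by
            rw [pow_succ', Perm.mul_apply]; simp [hψ, swap_apply_of_ne_of_ne hp h0]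
          rw [this]
          exact sameCycle_apply_right.2 ih
        · exact Or.inr (Or.inr ih)
  classical
  have hex : ∃ n, (φ ^ (n + 1)) q = q := ⟨orderOf φ - 1, by
    rw [Nat.sub_add_cancel (orderOf_pos φ), pow_orderOf_eq_one]; rfl⟩
  have hn := Nat.find_spec hex
  rcases hcase : Nat.find hex with _ | n
  · rw [hcase] at hn
    have : ψ p = q := by simpa [hψ] using hn
    rw [← this]
    exact sameCycle_apply_right.2 (SameCycle.refl _ _)
  · rw [hcase] at hn
    have hlt := Nat.find_min hex (m := n) (by omega)
    rcases key n with h1 | h1 | h1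
    · exact absurd h1 hlt
    · have hp : (φ ^ (n + 1)) q ≠ p := fun e =>
        h (e ▸ (sameCycle_pow_left.2 (SameCycle.refl _ _)))
      have : (φ ^ (n + 1 + 1)) q = ψ ((φ ^ (n + 1)) q) := by
        rw [pow_succ', Perm.mul_apply]; simp [hψ, swap_apply_of_ne_of_ne hp hlt]
      rw [← hn, this]
      exact sameCycle_apply_right.2 h1
    · exact h1

/-- Multiplication by a transposition merges two cycles. -/
theorem sameCycle_mul_swap_iff [Finite D] {φ : Perm D} {p q : D} (h : ¬ φ.SameCycle p q)
    {a b : D} : (φ * swap p q).SameCycle a b ↔ φ.SameCycle a b ∨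
      ((φ.SameCycle a p ∨ φ.SameCycle a q) ∧ (φ.SameCycle b p ∨ φ.SameCycle b q)) := by
  set ψ := φ * swap p q with hψ
  have hpq : ψ.SameCycle p q := sameCycle_mul_swap_self h
  have hin : ∀ {a b}, φ.SameCycle a b → ψ.SameCycle a b := fun {a b} hab => by
    rcases hab.mul_swap p q with h1 | ⟨h1 | h1, h2 | h2⟩
    · exact h1
    · exact h1.trans h2.symm
    · exact (h1.trans hpq).trans h2.symm
    · exact (h1.trans hpq.symm).trans h2.symm
    · exact h1.trans h2.symm
  constructor
  · intro hab
    have hφ : φ = ψ * swap p q := by rw [hψ, mul_assoc, swap_mul_self, mul_one]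
    rw [hφ]
    exact hab.mul_swap p q
  · rintro (h1 | ⟨h1 | h1, h2 | h2⟩)
    · exact hin h1
    · exact (hin h1).trans (hin h2).symm
    · exact ((hin h1).trans hpq).trans (hin h2).symm
    · exact ((hin h1).trans hpq.symm).trans (hin h2).symm
    · exact (hin h1).trans (hin h2).symm

/-- Multiplication by a transposition splits a cycle. -/
theorem not_sameCycle_mul_swap [Finite D] {φ : Perm D} {p q : D} (hne : p ≠ q)
    (h : φ.SameCycle p q) : ¬ (φ * swap p q).SameCycle p q := by
  set ψ := φ * swap p q with hψ
  classical
  -- The first positive time at which the φ-orbit of q meets {p, q}. It must meet p first, since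
  -- otherwise the cycle of q closes without containing p. The product then runs through this same
  -- arc from p back to p, missing q.
  have hex : ∃ n, (φ ^ (n + 1)) q ∈ ({p, q} : Set D) := ⟨orderOf φ - 1, by
    rw [Nat.sub_add_cancel (orderOf_pos φ), pow_orderOf_eq_one]; simp⟩
  set n := Nat.find hex with hn
  have hmin : ∀ m < n, (φ ^ (m + 1)) q ∉ ({p, q} : Set D) := fun m hm => Nat.find_min hex hm
  have hnp : (φ ^ (n + 1)) q = p := by
    rcases Nat.find_spec hex with h1 | h1
    · exact h1
    · exfalso
      have h1 : (φ ^ (n + 1)) q = q := h1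
      obtain ⟨k, hk⟩ := h.symm.exists_nat_pow_eq
      rw [← Nat.mod_add_div k (n + 1), pow_add, pow_mul, Perm.mul_apply] at hk
      have h3 : ((φ ^ (n + 1)) ^ (k / (n + 1))) q = q :=
        Perm.pow_apply_eq_self_of_apply_eq_self h1 _
      rw [h3] at hk
      have hlt : k % (n + 1) < n + 1 := Nat.mod_lt _ (by omega)
      rcases hm : k % (n + 1) with _ | m
      · rw [hm] at hk; exact hne (by simpa using hk.symm)
      · rw [hm] at hk
        exact hmin m (by omega) (by rw [hk]; simp)
  have hpow : ∀ m ≤ n, (ψ ^ (m + 1)) p = (φ ^ (m + 1)) q := by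
    intro m
    induction m with
    | zero => intro _; simp [hψ]
    | succ m ih =>
      intro hm
      have := hmin m (by omega)
      simp only [Set.mem_insert_iff, Set.mem_singleton_iff, not_or] at this
      rw [pow_succ', Perm.mul_apply, ih (by omega), Perm.mul_apply,
        swap_apply_of_ne_of_ne this.1 this.2, pow_succ' φ (m + 1), Perm.mul_apply]
  intro hc
  have h1 : (ψ ^ (n + 1)) p = p := by rw [hpow n le_rfl, hnp]
  obtain ⟨k, hk⟩ := hc.exists_nat_pow_eq
  rw [← Nat.mod_add_div k (n + 1), pow_add, pow_mul, Perm.mul_apply] at hk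
  have h3 : ((ψ ^ (n + 1)) ^ (k / (n + 1))) p = p :=
    Perm.pow_apply_eq_self_of_apply_eq_self h1 _
  rw [h3] at hk
  have hlt : k % (n + 1) < n + 1 := Nat.mod_lt _ (by omega)
  rcases hm : k % (n + 1) with _ | m
  · rw [hm] at hk; exact hne (by simpa using hk)
  · rw [hm, hpow m (by omega)] at hk
    exact hmin m (by omega) (by rw [hk]; simp)

/-- The sign of a permutation in terms of the number of its cycles, fixed points included. -/
theorem sign_eq_neg_one_pow_card_cycles [Fintype D] (σ : Perm D) :
    (sign σ : ℤ) = (-1) ^ (Fintype.card D + Nat.card (Quotient (SameCycle.setoid σ))) := by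
  classical
  -- The fibres of this map are the cycles of σ. Mathlib's cycle type omits the fixed points, which
  -- are counted in the second summand.
  let g : D → σ.cycleFactorsFinset ⊕ {x // σ x = x} := fun x =>
    if h : σ x = x then Sum.inr ⟨x, h⟩
    else Sum.inl ⟨σ.cycleOf x, cycleOf_mem_cycleFactorsFinset_iff.2 (by simpa using h)⟩
  have hg : Function.Surjective g := by
    rintro (⟨c, hc⟩ | ⟨x, hx⟩)
    · obtain ⟨x, hx⟩ := (mem_cycleFactorsFinset_iff.1 hc).1.nonempty_support
      have hcx := (cycle_is_cycleOf hx hc)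
      have hx' : x ∈ σ.support := mem_cycleFactorsFinset_support_le hc hx
      refine ⟨x, ?_⟩
      have : ¬ σ x = x := by simpa using hx'
      simp only [g, this, dite_false]
      congr 2
      exact hcx.symm
    · exact ⟨x, by simp [g, hx]⟩
  have hker : SameCycle.setoid σ = Setoid.ker g := by
    ext x y
    change σ.SameCycle x y ↔ g x = g y
    by_cases hx : σ x = x <;> by_cases hy : σ y = y
    · simp only [g, hx, hy, dite_true, Sum.inr.injEq, Subtype.mk.injEq]
      exact ⟨fun h => h.eq_of_left hx, fun h => h ▸ SameCycle.refl _ _⟩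
    · simp only [g, hx, hy, dite_true, dite_false, reduceCtorEq, iff_false]
      exact fun h => hy (h.apply_eq_self_iff.1 hx)
    · simp only [g, hx, hy, dite_true, dite_false, reduceCtorEq, iff_false]
      exact fun h => hx (h.apply_eq_self_iff.2 hy)
    · simp only [g, hx, hy, dite_false, Sum.inl.injEq, Subtype.mk.injEq]
      exact sameCycle_iff_cycleOf_eq_of_mem_support (by simpa using hx) (by simpa using hy)
  have hcard : Nat.card (Quotient (SameCycle.setoid σ)) =
      σ.cycleType.card + Fintype.card {x // σ x = x} := by
    rw [hker, Nat.card_congr (Setoid.quotientKerEquivOfSurjective g hg), Nat.card_sum]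
    simp [cycleType_def, Nat.card_eq_fintype_card]
  have hfix : Fintype.card {x // σ x = x} + σ.cycleType.sum = Fintype.card D := by
    rw [sum_cycleType, Fintype.card_subtype, ← Finset.card_univ,
      ← Finset.card_filter_add_card_filter_not (s := Finset.univ) (fun x => σ x = x)]
    congr 1
  rw [sign_of_cycleType, hcard, ← hfix]
  push_cast
  rw [show Fintype.card {x // σ x = x} + σ.cycleType.sum +
    (σ.cycleType.card + Fintype.card {x // σ x = x}) = σ.cycleType.sum + σ.cycleType.card +
      2 * Fintype.card {x // σ x = x} by ring, pow_add _ _ (2 * _), pow_mul]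
  simp

end Equiv.Perm

namespace Graph

variable {α β : Type*}

/-! ### Reachability -/

theorem Reachable.refl (G : Graph α β) (x : α) : G.Reachable x x := Relation.ReflTransGen.refl

theorem Reachable.trans {G : Graph α β} {x y z : α} (h : G.Reachable x y) (h' : G.Reachable y z) :
    G.Reachable x z := Relation.ReflTransGen.trans h h'

theorem Reachable.symm {G : Graph α β} {x y : α} (h : G.Reachable x y) : G.Reachable y x :=
  Relation.ReflTransGen.stdSymm.symm _ _ h

theorem IsLink.reachable {G : Graph α β} {e : β} {x y : α} (h : G.IsLink e x y) :
    G.Reachable x y := Relation.ReflTransGen.single h.adj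

/-- Walks can be transferred along a vertex map that sends adjacent vertices to joined ones. -/
theorem Reachable.map {G H : Graph α β} (r : α → α)
    (hr : ∀ e x y, G.IsLink e x y → H.Reachable (r x) (r y)) {x y : α} (h : G.Reachable x y) :
    H.Reachable (r x) (r y) := by
  induction h with
  | refl => exact .refl _ _
  | tail _ hadj ih =>
    obtain ⟨e, he⟩ := hadj
    exact ih.trans (hr _ _ _ he)

theorem Reachable.mono {G H : Graph α β} (hle : ∀ e x y, G.IsLink e x y → H.IsLink e x y) {x y : α}
    (h : G.Reachable x y) : H.Reachable x y :=
  Reachable.map id (fun e x y he => (hle e x y he).reachable) h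

theorem Reachable.eq_or_exists_isLink {G : Graph α β} {x y : α} (h : G.Reachable x y) :
    x = y ∨ ∃ e z, G.IsLink e x z := by
  rcases Relation.ReflTransGen.cases_head h with h | ⟨z, ⟨e, he⟩, _⟩
  · exact Or.inl h
  · exact Or.inr ⟨e, z, he⟩

/-- Every proper set of vertices of a connected graph that is not empty is left by an edge. -/
theorem IsConnected.exists_isLink_boundary {T : Graph α β} (hT : T.IsConnected) {C : Set α}
    {r v : α} (hr : r ∈ V(T)) (hrC : r ∈ C) (hv : v ∈ V(T)) (hvC : v ∉ C) :
    ∃ e x y, T.IsLink e x y ∧ x ∈ C ∧ y ∉ C := by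
  have h := hT.2 r hr v hv
  by_contra hcon
  push Not at hcon
  have : ∀ z, T.Reachable r z → z ∈ C := by
    intro z hz
    induction hz with
    | refl => exact hrC
    | tail _ hadj ih =>
      obtain ⟨e, he⟩ := hadj
      exact hcon _ _ _ he ih
  exact hvC (this v h)

/-! ### Two-connected cubic graphs -/

/-- Without a cutvertex, a loop is the only edge at its vertex, which then has valency 2 instead of
3. -/
theorem IsTwoConnected.loopless {G : Graph α β} (h : G.IsTwoConnected) (hc : G.IsCubic) (e : β)
    (x : α) : ¬ G.IsLink e x x := by
  intro he
  have hx := he.left_mem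
  have hall : ∀ f, G.Inc f x → f = e := by
    intro f hf
    by_contra hne
    exact h.2 x ⟨hx, Or.inr ⟨e, f, he, hf, hne⟩⟩
  have h1 : G.incidenceSet x = {e} := by
    ext f
    simp only [mem_incidenceSet, Set.mem_singleton_iff]
    exact ⟨hall f, fun h => h ▸ he.inc_left⟩
  have h2 : G.loopSet x = {e} := by
    ext f
    simp only [mem_loopSet, Set.mem_singleton_iff]
    exact ⟨fun hf => hall f hf.inc, fun h => h ▸ he⟩
  have := hc.2 x hx
  rw [valency, h1, h2] at this
  simp at this

theorem valency_of_loopless {G : Graph α β} (h : ∀ e x, ¬ G.IsLink e x x) (x : α) :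
    G.valency x = (G.incidenceSet x).ncard := by
  have : G.loopSet x = ∅ := by
    ext e
    simp only [mem_loopSet, Set.mem_empty_iff_false, iff_false]
    exact h e x
  rw [valency, this]
  simp

theorem IsCubic.ncard_incidenceSet {G : Graph α β} (hc : G.IsCubic)
    (h : ∀ e x, ¬ G.IsLink e x x) {x : α} (hx : x ∈ V(G)) : (G.incidenceSet x).ncard = 3 := by
  rw [← valency_of_loopless h, hc.2 x hx]

/-- An edge without parallel edges in a `2`-connected cubic graph is not a bridge. -/
theorem IsTwoConnected.not_isBridge {G : Graph α β} (h : G.IsTwoConnected) (hc : G.IsCubic)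
    {e : β} {x y : α} (he : ∀ f, G.IsLink f x y ↔ f = e) : ¬ G.IsBridge e := by
  rintro ⟨x', y', hl, hb⟩
  have hxy : G.IsLink e x y := (he e).2 rfl
  have hl3 := hc.ncard_incidenceSet (h.loopless hc) hxy.left_mem
  have hne : ∃ f ∈ G.incidenceSet x, f ≠ e := by
    by_contra hcon
    push Not at hcon
    have : G.incidenceSet x ⊆ {e} := hcon
    have := Set.ncard_le_ncard this
    simp [hl3] at this
  obtain ⟨f, ⟨z, hf⟩, hfe⟩ := hne
  have hzx : z ≠ x := fun hz => h.loopless hc f x (hz ▸ hf)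
  have hyx : y ≠ x := fun hz => h.loopless hc e x (hz ▸ hxy)
  have hyz : (G.deleteVerts {x}).Reachable z y := by
    by_contra hcon
    exact h.2 x ⟨hxy.left_mem, Or.inl ⟨z, hf.right_mem, y, hxy.right_mem, hzx, hyx, hcon⟩⟩
  have h1 : (G.deleteEdges {e}).Reachable z y := by
    refine hyz.mono fun g u v hg => ?_
    rw [deleteVerts_isLink] at hg
    rw [deleteEdges_isLink]
    refine ⟨hg.1, ?_⟩
    rintro rfl
    rcases hg.1.eq_and_eq_or_eq_and_eq hxy with ⟨rfl, -⟩ | ⟨-, rfl⟩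
    · exact hg.2.1 rfl
    · exact hg.2.2 rfl
  have h2 : (G.deleteEdges {e}).Reachable x y := by
    refine Reachable.trans (IsLink.reachable (e := f) ?_) h1
    rw [deleteEdges_isLink]
    exact ⟨hf, hfe⟩
  rcases hl.eq_and_eq_or_eq_and_eq hxy with ⟨rfl, rfl⟩ | ⟨rfl, rfl⟩
  · exact hb h2
  · exact hb h2.symm

/-! ### Two-sums -/

/-- The data of a `2`-sum with named ends and new edges. -/
structure TwoSumData (G G₁ G₂ : Graph α β) (e₁ e₂ f₁ f₂ : β) (a₁ b₁ a₂ b₂ : α) : Prop where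
  disjV : Disjoint V(G₁) V(G₂)
  disjE : Disjoint E(G₁) E(G₂)
  f_ne : f₁ ≠ f₂
  f₁_notMem : f₁ ∉ E(G₁) ∪ E(G₂)
  f₂_notMem : f₂ ∉ E(G₁) ∪ E(G₂)
  link₁ : G₁.IsLink e₁ a₁ b₁
  ne₁ : a₁ ≠ b₁
  link₂ : G₂.IsLink e₂ a₂ b₂
  ne₂ : a₂ ≠ b₂
  vertexSet_eq : V(G) = V(G₁) ∪ V(G₂)
  isLink_iff : ∀ e x y, G.IsLink e x y ↔
    (G₁.deleteEdges {e₁}).IsLink e x y ∨ (G₂.deleteEdges {e₂}).IsLink e x y ∨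
      (e = f₁ ∧ s(x, y) = s(a₁, a₂)) ∨ (e = f₂ ∧ s(x, y) = s(b₁, b₂))

namespace TwoSumData

variable {G G₁ G₂ : Graph α β} {e₁ e₂ f₁ f₂ : β} {a₁ b₁ a₂ b₂ : α}

/-- Together with `flip`, which exchanges the roles of the two new edges, this reduces later
arguments to the side G₁ and to the edge f₁. -/
theorem swap (D : TwoSumData G G₁ G₂ e₁ e₂ f₁ f₂ a₁ b₁ a₂ b₂) :
    TwoSumData G G₂ G₁ e₂ e₁ f₁ f₂ a₂ b₂ a₁ b₁ where
  disjV := D.disjV.symm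
  disjE := D.disjE.symm
  f_ne := D.f_ne
  f₁_notMem := by rw [Set.union_comm]; exact D.f₁_notMem
  f₂_notMem := by rw [Set.union_comm]; exact D.f₂_notMem
  link₁ := D.link₂
  ne₁ := D.ne₂
  link₂ := D.link₁
  ne₂ := D.ne₁
  vertexSet_eq := by rw [Set.union_comm]; exact D.vertexSet_eq
  isLink_iff e x y := by
    rw [D.isLink_iff, Sym2.eq_swap (a := a₂), Sym2.eq_swap (a := b₂)]
    tauto

theorem flip (D : TwoSumData G G₁ G₂ e₁ e₂ f₁ f₂ a₁ b₁ a₂ b₂) :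
    TwoSumData G G₁ G₂ e₁ e₂ f₂ f₁ b₁ a₁ b₂ a₂ where
  disjV := D.disjV
  disjE := D.disjE
  f_ne := D.f_ne.symm
  f₁_notMem := D.f₂_notMem
  f₂_notMem := D.f₁_notMem
  link₁ := D.link₁.symm
  ne₁ := D.ne₁.symm
  link₂ := D.link₂.symm
  ne₂ := D.ne₂.symm
  vertexSet_eq := D.vertexSet_eq
  isLink_iff e x y := by
    rw [D.isLink_iff]
    tauto

variable (D : TwoSumData G G₁ G₂ e₁ e₂ f₁ f₂ a₁ b₁ a₂ b₂)
include D

theorem isLink_f₁ : G.IsLink f₁ a₁ a₂ := by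
  rw [D.isLink_iff]; exact Or.inr (Or.inr (Or.inl ⟨rfl, rfl⟩))

theorem isLink_f₂ : G.IsLink f₂ b₁ b₂ := D.flip.isLink_f₁

theorem isLink_of_left {e : β} {x y : α} (h : G₁.IsLink e x y) (he : e ≠ e₁) : G.IsLink e x y := by
  rw [D.isLink_iff]; exact Or.inl (by rw [deleteEdges_isLink]; exact ⟨h, he⟩)

theorem isLink_of_right {e : β} {x y : α} (h : G₂.IsLink e x y) (he : e ≠ e₂) : G.IsLink e x y :=
  D.swap.isLink_of_left h he

theorem ne_f₁_of_mem_left {e : β} (h : e ∈ E(G₁)) : e ≠ f₁ :=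
  fun he => D.f₁_notMem (Or.inl (he ▸ h))

theorem ne_f₂_of_mem_left {e : β} (h : e ∈ E(G₁)) : e ≠ f₂ :=
  fun he => D.f₂_notMem (Or.inl (he ▸ h))

theorem notMem_right {x : α} (h : x ∈ V(G₁)) : x ∉ V(G₂) := fun h' => Set.disjoint_left.1 D.disjV h h'

theorem notMem_left {x : α} (h : x ∈ V(G₂)) : x ∉ V(G₁) := D.swap.notMem_right h

theorem isLink_cases {e : β} {x y : α} (h : G.IsLink e x y) :
    (G₁.IsLink e x y ∧ e ≠ e₁) ∨ (G₂.IsLink e x y ∧ e ≠ e₂) ∨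
      (e = f₁ ∧ (x = a₁ ∧ y = a₂ ∨ x = a₂ ∧ y = a₁)) ∨
      (e = f₂ ∧ (x = b₁ ∧ y = b₂ ∨ x = b₂ ∧ y = b₁)) := by
  rw [D.isLink_iff] at h
  simpa [deleteEdges_isLink] using h

/-- A link of the `2`-sum between vertices of the first graph comes from that graph. -/
theorem isLink_left {e : β} {x y : α} (h : G.IsLink e x y) (hx : x ∈ V(G₁)) (hy : y ∈ V(G₁)) :
    G₁.IsLink e x y ∧ e ≠ e₁ := by
  rcases D.isLink_cases h with h | ⟨h, -⟩ | ⟨rfl, ⟨rfl, rfl⟩ | ⟨rfl, rfl⟩⟩ |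
    ⟨rfl, ⟨rfl, rfl⟩ | ⟨rfl, rfl⟩⟩
  · exact h
  · exact absurd h.left_mem (D.notMem_right hx)
  · exact absurd hy (D.notMem_left D.link₂.left_mem)
  · exact absurd hx (D.notMem_left D.link₂.left_mem)
  · exact absurd hy (D.notMem_left D.link₂.right_mem)
  · exact absurd hx (D.notMem_left D.link₂.right_mem)

theorem edgeSet_eq : E(G) = ((E(G₁) \ {e₁}) ∪ (E(G₂) \ {e₂})) ∪ {f₁, f₂} := by
  ext e
  constructor
  · intro h
    obtain ⟨x, y, h⟩ := exists_isLink_of_mem_edgeSet h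
    rcases D.isLink_cases h with ⟨h, hne⟩ | ⟨h, hne⟩ | ⟨rfl, -⟩ | ⟨rfl, -⟩
    · exact Or.inl (Or.inl ⟨h.edge_mem, hne⟩)
    · exact Or.inl (Or.inr ⟨h.edge_mem, hne⟩)
    · simp
    · simp
  · rintro ((⟨h, hne⟩ | ⟨h, hne⟩) | (rfl | rfl))
    · obtain ⟨x, y, h⟩ := exists_isLink_of_mem_edgeSet h
      exact (D.isLink_of_left h hne).edge_mem
    · obtain ⟨x, y, h⟩ := exists_isLink_of_mem_edgeSet h
      exact (D.isLink_of_right h hne).edge_mem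
    · exact D.isLink_f₁.edge_mem
    · exact D.isLink_f₂.edge_mem

theorem isFinite (h₁ : G₁.IsFinite) (h₂ : G₂.IsFinite) : G.IsFinite := by
  refine ⟨?_, ?_⟩
  · rw [D.vertexSet_eq]; exact h₁.1.union h₂.1
  · rw [D.edgeSet_eq]
    exact ((h₁.2.sdiff).union (h₂.2.sdiff)).union (Set.toFinite _)

theorem ncard_vertexSet (h₁ : G₁.IsFinite) (h₂ : G₂.IsFinite) :
    V(G).ncard = V(G₁).ncard + V(G₂).ncard := by
  rw [D.vertexSet_eq, Set.ncard_union_eq D.disjV h₁.1 h₂.1]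

theorem ncard_edgeSet (h₁ : G₁.IsFinite) (h₂ : G₂.IsFinite) :
    E(G).ncard = E(G₁).ncard + E(G₂).ncard := by
  have hd : Disjoint (E(G₁) \ {e₁}) (E(G₂) \ {e₂}) :=
    D.disjE.mono Set.sdiff_subset Set.sdiff_subset
  have hd' : Disjoint ((E(G₁) \ {e₁}) ∪ (E(G₂) \ {e₂})) {f₁, f₂} := by
    rw [Set.disjoint_right]
    have h1 := D.f₁_notMem
    have h2 := D.f₂_notMem
    rintro e (rfl | rfl) (he | he)
    · exact h1 (Or.inl he.1)
    · exact h1 (Or.inr he.1)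
    · exact h2 (Or.inl he.1)
    · exact h2 (Or.inr he.1)
  rw [D.edgeSet_eq, Set.ncard_union_eq hd' (h₁.2.sdiff.union h₂.2.sdiff) (Set.toFinite _),
    Set.ncard_union_eq hd h₁.2.sdiff h₂.2.sdiff, Set.ncard_pair D.f_ne]
  have := Set.ncard_sdiff_singleton_add_one D.link₁.edge_mem h₁.2
  have := Set.ncard_sdiff_singleton_add_one D.link₂.edge_mem h₂.2
  omega

theorem loopless (h₁ : ∀ e x, ¬ G₁.IsLink e x x) (h₂ : ∀ e x, ¬ G₂.IsLink e x x) (e : β) (x : α) :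
    ¬ G.IsLink e x x := by
  have ha : a₁ ≠ a₂ := fun h => D.notMem_right D.link₁.left_mem (h ▸ D.link₂.left_mem)
  have hb : b₁ ≠ b₂ := fun h => D.notMem_right D.link₁.right_mem (h ▸ D.link₂.right_mem)
  intro h
  rcases D.isLink_cases h with h | h | h | h
  · exact h₁ e x h.1
  · exact h₂ e x h.1
  · rcases h.2 with ⟨h, h'⟩ | ⟨h, h'⟩
    · exact ha (h.symm.trans h')
    · exact ha (h'.symm.trans h)
  · rcases h.2 with ⟨h, h'⟩ | ⟨h, h'⟩
    · exact hb (h.symm.trans h')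
    · exact hb (h'.symm.trans h)

theorem incidenceSet_of_ne {x : α} (hx : x ∈ V(G₁)) (ha : x ≠ a₁) (hb : x ≠ b₁) :
    G.incidenceSet x = G₁.incidenceSet x := by
  ext e
  constructor
  · rintro ⟨y, h⟩
    rcases D.isLink_cases h with ⟨h, -⟩ | ⟨h, -⟩ | ⟨rfl, ⟨rfl, rfl⟩ | ⟨rfl, rfl⟩⟩ |
      ⟨rfl, ⟨rfl, rfl⟩ | ⟨rfl, rfl⟩⟩
    · exact h.inc_left
    · exact absurd h.left_mem (D.notMem_right hx)
    · exact absurd rfl ha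
    · exact absurd hx (D.notMem_left D.link₂.left_mem)
    · exact absurd rfl hb
    · exact absurd hx (D.notMem_left D.link₂.right_mem)
  · rintro ⟨y, h⟩
    refine (D.isLink_of_left h ?_).inc_left
    rintro rfl
    rcases h.left_eq_or_eq D.link₁ with h | h
    · exact ha h
    · exact hb h

theorem incidenceSet_a₁ : G.incidenceSet a₁ = insert f₁ (G₁.incidenceSet a₁ \ {e₁}) := by
  ext e
  constructor
  · rintro ⟨y, h⟩
    rcases D.isLink_cases h with ⟨h, hne⟩ | ⟨h, -⟩ | ⟨rfl, -⟩ | ⟨rfl, ⟨h, -⟩ | ⟨h, -⟩⟩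
    · exact Or.inr ⟨h.inc_left, hne⟩
    · exact absurd h.left_mem (D.notMem_right D.link₁.left_mem)
    · exact Or.inl rfl
    · exact absurd h D.ne₁
    · exact absurd (h ▸ D.link₂.right_mem) (D.notMem_right D.link₁.left_mem)
  · rintro (rfl | ⟨⟨y, h⟩, hne⟩)
    · exact D.isLink_f₁.inc_left
    · exact (D.isLink_of_left h hne).inc_left

theorem ncard_incidenceSet_a₁ (h₁ : G₁.IsFinite) :
    (G.incidenceSet a₁).ncard = (G₁.incidenceSet a₁).ncard := by
  have hfin : (G₁.incidenceSet a₁).Finite := h₁.2.subset (G₁.incidenceSet_subset_edgeSet a₁)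
  rw [D.incidenceSet_a₁, Set.ncard_insert_of_notMem _ hfin.sdiff,
    Set.ncard_sdiff_singleton_add_one
      (show e₁ ∈ G₁.incidenceSet a₁ from D.link₁.inc_left) hfin]
  rintro ⟨h, -⟩
  exact D.f₁_notMem (Or.inl h.edge_mem)

theorem ncard_incidenceSet_left (h₁ : G₁.IsFinite) {x : α} (hx : x ∈ V(G₁)) :
    (G.incidenceSet x).ncard = (G₁.incidenceSet x).ncard := by
  by_cases ha : x = a₁
  · rw [ha, D.ncard_incidenceSet_a₁ h₁]
  by_cases hb : x = b₁
  · rw [hb, D.flip.ncard_incidenceSet_a₁ h₁]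
  rw [D.incidenceSet_of_ne hx ha hb]

theorem isCubic (c₁ : G₁.IsCubic) (c₂ : G₂.IsCubic) (h₁ : ∀ e x, ¬ G₁.IsLink e x x)
    (h₂ : ∀ e x, ¬ G₂.IsLink e x x) : G.IsCubic := by
  refine ⟨D.isFinite c₁.1 c₂.1, fun x hx => ?_⟩
  rw [valency_of_loopless (D.loopless h₁ h₂)]
  rw [D.vertexSet_eq] at hx
  rcases hx with hx | hx
  · rw [D.ncard_incidenceSet_left c₁.1 hx, c₁.ncard_incidenceSet h₁ hx]
  · rw [D.swap.ncard_incidenceSet_left c₂.1 hx, c₂.ncard_incidenceSet h₂ hx]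

/-- If `G₂ - e₂` is connected, walks of `G₁ - v` give rise to walks of `G - v`. -/
theorem reachable_left (hc₂ : ∀ x ∈ V(G₂), ∀ y ∈ V(G₂), (G₂.deleteEdges {e₂}).Reachable x y)
    {v : α} (hv : v ∈ V(G₁)) {x y : α} (h : (G₁.deleteVerts {v}).Reachable x y) :
    (G.deleteVerts {v}).Reachable x y := by
  have hr : ∀ x ∈ V(G₂), ∀ y ∈ V(G₂), (G.deleteVerts {v}).Reachable x y := by
    intro x hx y hy
    refine (hc₂ x hx y hy).mono fun e x y h => ?_
    rw [deleteEdges_isLink] at h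
    rw [deleteVerts_isLink]
    exact ⟨D.isLink_of_right h.1 h.2, fun hxv => D.notMem_right hv (hxv ▸ h.1.left_mem),
      fun hyv => D.notMem_right hv (hyv ▸ h.1.right_mem)⟩
  -- The substitute for a passage along e₁: cross f₁, walk through G₂ − e₂, come back along f₂.
  have key : a₁ ≠ v → b₁ ≠ v → (G.deleteVerts {v}).Reachable a₁ b₁ := by
    intro ha hb
    have h1 : (G.deleteVerts {v}).IsLink f₁ a₁ a₂ := by
      rw [deleteVerts_isLink]
      refine ⟨D.isLink_f₁, ha, ?_⟩
      rintro rfl; exact D.notMem_right hv D.link₂.left_mem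
    have h2 : (G.deleteVerts {v}).IsLink f₂ b₁ b₂ := by
      rw [deleteVerts_isLink]
      refine ⟨D.isLink_f₂, hb, ?_⟩
      rintro rfl; exact D.notMem_right hv D.link₂.right_mem
    exact (h1.reachable.trans (hr _ D.link₂.left_mem _ D.link₂.right_mem)).trans h2.symm.reachable
  refine h.map id fun e x y he => ?_
  rw [deleteVerts_isLink] at he
  by_cases hee : e = e₁
  · subst hee
    rcases he.1.eq_and_eq_or_eq_and_eq D.link₁ with ⟨rfl, rfl⟩ | ⟨rfl, rfl⟩
    · exact key he.2.1 he.2.2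
    · exact (key he.2.2 he.2.1).symm
  · refine IsLink.reachable (e := e) ?_
    rw [deleteVerts_isLink]
    exact ⟨D.isLink_of_left he.1 hee, he.2⟩

/-- With v on the first side, G₂ − e₂ remains intact, and v is an end of at most one of f₁ and f₂.
So the other new edge still joins the rest of G₁ to the second side. -/
theorem reachable_deleteVerts (t₁ : G₁.IsTwoConnected)
    (hc₂ : ∀ x ∈ V(G₂), ∀ y ∈ V(G₂), (G₂.deleteEdges {e₂}).Reachable x y)
    {v : α} (hv : v ∈ V(G₁)) {x : α} (hx : x ∈ V(G)) (hxv : x ≠ v) :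
    (G.deleteVerts {v}).Reachable x a₂ := by
  have hr : ∀ x ∈ V(G₂), ∀ y ∈ V(G₂), (G.deleteVerts {v}).Reachable x y := by
    intro x hx y hy
    refine (hc₂ x hx y hy).mono fun e x y h => ?_
    rw [deleteEdges_isLink] at h
    rw [deleteVerts_isLink]
    exact ⟨D.isLink_of_right h.1 h.2, fun hxv => D.notMem_right hv (hxv ▸ h.1.left_mem),
      fun hyv => D.notMem_right hv (hyv ▸ h.1.right_mem)⟩
  have hl : ∀ x ∈ V(G₁), x ≠ v → ∀ y ∈ V(G₁), y ≠ v → (G.deleteVerts {v}).Reachable x y := by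
    intro x hx hxv y hy hyv
    refine D.reachable_left hc₂ hv ?_
    by_contra hcon
    exact t₁.2 v ⟨hv, Or.inl ⟨x, hx, y, hy, hxv, hyv, hcon⟩⟩
  rw [D.vertexSet_eq] at hx
  rcases hx with hx | hx
  · by_cases ha : a₁ = v
    · have hb : b₁ ≠ v := fun h => D.ne₁ (ha.trans h.symm)
      have h2 : (G.deleteVerts {v}).IsLink f₂ b₁ b₂ := by
        rw [deleteVerts_isLink]
        refine ⟨D.isLink_f₂, hb, ?_⟩
        rintro rfl; exact D.notMem_right hv D.link₂.right_mem
      exact ((hl x hx hxv _ D.link₁.right_mem hb).trans h2.reachable).trans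
        (hr _ D.link₂.right_mem _ D.link₂.left_mem)
    · have h1 : (G.deleteVerts {v}).IsLink f₁ a₁ a₂ := by
        rw [deleteVerts_isLink]
        refine ⟨D.isLink_f₁, ha, ?_⟩
        rintro rfl; exact D.notMem_right hv D.link₂.left_mem
      exact (hl x hx hxv _ D.link₁.left_mem ha).trans h1.reachable
  · exact hr x hx _ D.link₂.left_mem

theorem isTwoConnected (t₁ : G₁.IsTwoConnected) (t₂ : G₂.IsTwoConnected)
    (hl₁ : ∀ e x, ¬ G₁.IsLink e x x) (hl₂ : ∀ e x, ¬ G₂.IsLink e x x)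
    (hc₁ : ∀ x ∈ V(G₁), ∀ y ∈ V(G₁), (G₁.deleteEdges {e₁}).Reachable x y)
    (hc₂ : ∀ x ∈ V(G₂), ∀ y ∈ V(G₂), (G₂.deleteEdges {e₂}).Reachable x y) :
    G.IsTwoConnected := by
  have hr₁ : ∀ x ∈ V(G₁), G.Reachable x a₁ := fun x hx =>
    (hc₁ x hx _ D.link₁.left_mem).mono fun e u v h => by
      rw [deleteEdges_isLink] at h; exact D.isLink_of_left h.1 h.2
  have hr₂ : ∀ x ∈ V(G₂), G.Reachable x a₂ := fun x hx =>
    (hc₂ x hx _ D.link₂.left_mem).mono fun e u v h => by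
      rw [deleteEdges_isLink] at h; exact D.isLink_of_right h.1 h.2
  have hr : ∀ x ∈ V(G), G.Reachable x a₁ := fun x hx => by
    rw [D.vertexSet_eq] at hx
    rcases hx with hx | hx
    · exact hr₁ x hx
    · exact (hr₂ x hx).trans D.isLink_f₁.symm.reachable
  refine ⟨⟨⟨a₁, D.isLink_f₁.left_mem⟩, fun x hx y hy => (hr x hx).trans (hr y hy).symm⟩, ?_⟩
  rintro v ⟨hv, ⟨x, hx, y, hy, hxv, hyv, hn⟩ | ⟨e, f, he, -⟩⟩
  · rw [D.vertexSet_eq] at hv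
    rcases hv with hv | hv
    · exact hn ((D.reachable_deleteVerts t₁ hc₂ hv hx hxv).trans
        (D.reachable_deleteVerts t₁ hc₂ hv hy hyv).symm)
    · exact hn ((D.swap.reachable_deleteVerts t₂ hc₁ hv hx hxv).trans
        (D.swap.reachable_deleteVerts t₂ hc₁ hv hy hyv).symm)
  · exact D.loopless hl₁ hl₂ e v he

end TwoSumData

end Graph

namespace Graph

variable {α β : Type*}

open Equiv.Perm

/-! ### Faces of rotation systems -/

namespace RotationSystem

variable {G : Graph α β} (R : G.RotationSystem)

theorem isLink_org (e : E(G)) (b : Bool) : G.IsLink e (R.org (e, b)) (R.org (e, !b)) := by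
  cases b
  · exact R.isLink e
  · exact (R.isLink e).symm

theorem inc_org (d : G.Dart) : G.Inc d.1 (R.org d) := (R.isLink_org d.1 d.2).inc_left

theorem exists_org_eq {e : β} {x : α} (h : G.Inc e x) :
    ∃ b, R.org (⟨e, h.edge_mem⟩, b) = x := by
  rcases h.eq_or_eq_of_isLink (R.isLink ⟨e, h.edge_mem⟩) with h | h
  · exact ⟨_, h.symm⟩
  · exact ⟨_, h.symm⟩

theorem org_rot (d : G.Dart) : R.org (R.rot d) = R.org d :=
  (R.sameCycle_iff _ _).1 (sameCycle_apply_left.2 (SameCycle.refl _ _))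

theorem facePerm_apply (d : G.Dart) : R.facePerm d = R.rot (G.dartRev d) := rfl

end RotationSystem

theorem IsFinite.finite_dart {G : Graph α β} (h : G.IsFinite) : Finite G.Dart := by
  have := h.2.to_subtype
  infer_instance

/-- The number of faces has the same parity as `|V| + |E|`. -/
theorem RotationSystem.even_faceCount_add {G : Graph α β} (hG : G.IsFinite)
    (R : G.RotationSystem) : Even (R.faceCount + (V(G).ncard + E(G).ncard)) := by
  classical
  have hE : Fintype E(G) := hG.2.fintype
  -- The reversal is a product of |E| transpositions, whereas the sign of the rotation counts the
  -- vertices that are not isolated. The number of darts is even and drops out of both cycle counts.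
  have hrev : (sign G.dartRev : ℤ) = (-1) ^ E(G).ncard := by
    have : G.dartRev = Equiv.prodCongrRight fun _ => Equiv.boolNot := rfl
    rw [this, sign_prodCongrRight]
    have hs : sign Equiv.boolNot = -1 := by decide
    simp [hs]
  have hcard : Fintype.card G.Dart = 2 * E(G).ncard := by
    rw [Fintype.card_prod, Fintype.card_bool, mul_comm, ← Nat.card_coe_set_eq,
      Nat.card_eq_fintype_card]
  have hrot : Nat.card (Quotient (SameCycle.setoid R.rot)) =
      {x | x ∈ V(G) ∧ ∃ e, G.Inc e x}.ncard := by
    rw [← Nat.card_coe_set_eq]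
    let g : G.Dart → {x | x ∈ V(G) ∧ ∃ e, G.Inc e x} := fun d =>
      ⟨R.org d, (R.inc_org d).vertex_mem, d.1, R.inc_org d⟩
    have hg : Function.Surjective g := by
      rintro ⟨x, hx, e, he⟩
      obtain ⟨b, hb⟩ := R.exists_org_eq he
      exact ⟨_, Subtype.ext hb⟩
    have hker : SameCycle.setoid R.rot = Setoid.ker g := by
      ext x y
      change R.rot.SameCycle x y ↔ g x = g y
      rw [R.sameCycle_iff, Subtype.ext_iff]
    rw [hker]
    exact Nat.card_congr (Setoid.quotientKerEquivOfSurjective g hg)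
  have hV : {x | x ∈ V(G) ∧ ∃ e, G.Inc e x}.ncard + {x | x ∈ V(G) ∧ ∀ e, ¬ G.Inc e x}.ncard =
      V(G).ncard := by
    rw [← Set.ncard_union_eq _ (hG.1.subset fun x hx => hx.1) (hG.1.subset fun x hx => hx.1)]
    · congr 1
      ext x
      simp only [Set.mem_union, Set.mem_ofPred_eq]
      by_cases h : ∃ e, G.Inc e x
      · simp [h]
      · push Not at h
        simp [h]
    · rw [Set.disjoint_left]
      rintro x ⟨-, e, he⟩ ⟨-, h⟩
      exact h e he
  have hface : R.facePerm = R.rot * G.dartRev := rfl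
  have h1 := sign_eq_neg_one_pow_card_cycles R.facePerm
  rw [hface, Equiv.Perm.sign_mul, Units.val_mul, hrev, sign_eq_neg_one_pow_card_cycles R.rot, hcard, hrot,
    pow_add, pow_mul, pow_add _ (2 * _), pow_mul] at h1
  simp only [even_two, Even.neg_pow, one_pow, one_mul] at h1
  rw [RotationSystem.faceCount, hface, ← hV]
  set F := Nat.card (Quotient (SameCycle.setoid (R.rot * G.dartRev)))
  set A := {x | x ∈ V(G) ∧ ∃ e, G.Inc e x}.ncard
  set B := {x | x ∈ V(G) ∧ ∀ e, ¬ G.Inc e x}.ncard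
  have h2 : ((-1 : ℤ)) ^ (F + (A + E(G).ncard)) = 1 := by
    rw [pow_add, ← h1, ← pow_add, ← pow_add]
    exact Even.neg_one_pow ⟨_, rfl⟩
  have h3 := neg_one_pow_eq_one_iff_even (R := ℤ) (by norm_num) |>.1 h2
  -- Isolated vertices count both as vertices and as faces, so they do not affect the parity.
  have : F + B + (A + B + E(G).ncard) = (F + (A + E(G).ncard)) + (B + B) := by ring
  rw [this]
  exact h3.add ⟨B, rfl⟩

theorem RotationSystem.faceCount_pos {G : Graph α β} (hG : G.IsFinite) (hV : V(G).Nonempty)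
    (R : G.RotationSystem) : 0 < R.faceCount := by
  have := hG.finite_dart
  obtain ⟨x, hx⟩ := hV
  by_cases h : ∃ e, G.Inc e x
  · obtain ⟨e, he⟩ := h
    have : Nonempty (Quotient (SameCycle.setoid R.facePerm)) := ⟨⟦(⟨e, he.edge_mem⟩, true)⟧⟩
    exact Nat.add_pos_left Nat.card_pos _
  · push Not at h
    refine Nat.add_pos_right _ ?_
    rw [Set.ncard_pos (hG.1.subset fun x hx => hx.1)]
    exact ⟨x, hx, h⟩

/-- In a connected graph the faces are the cycles of the face permutation, unless there is no edge,
in which case there is one face. -/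
theorem RotationSystem.faceCount_le {G : Graph α β} (hc : G.IsConnected)
    (R : G.RotationSystem) {n : ℕ} (hn : 1 ≤ n)
    (h : Nat.card (Quotient (SameCycle.setoid R.facePerm)) ≤ n) : R.faceCount ≤ n := by
  by_cases hE : E(G).Nonempty
  · have : {x | x ∈ V(G) ∧ ∀ e, ¬ G.Inc e x} = ∅ := by
      ext x
      simp only [Set.mem_ofPred_eq, Set.mem_empty_iff_false, iff_false, not_and, not_forall, not_not]
      intro hx
      obtain ⟨e, he⟩ := hE
      obtain ⟨u, v, huv⟩ := exists_isLink_of_mem_edgeSet he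
      rcases (hc.2 x hx u huv.left_mem).eq_or_exists_isLink with rfl | ⟨f, z, hf⟩
      · exact ⟨e, huv.inc_left⟩
      · exact ⟨f, hf.inc_left⟩
    rw [RotationSystem.faceCount, this, Set.ncard_empty]
    exact h
  · rw [Set.not_nonempty_iff_eq_empty] at hE
    have h1 : Nat.card (Quotient (SameCycle.setoid R.facePerm)) = 0 := by
      have : IsEmpty (Quotient (SameCycle.setoid R.facePerm)) := by
        refine ⟨fun q => ?_⟩
        induction q using Quotient.inductionOn with
        | h d =>
          exact Set.eq_empty_iff_forall_notMem.1 hE _ d.1.2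
      exact Nat.card_of_isEmpty
    have h2 : {x | x ∈ V(G) ∧ ∀ e, ¬ G.Inc e x}.ncard ≤ 1 := by
      have hs : {x | x ∈ V(G) ∧ ∀ e, ¬ G.Inc e x}.Subsingleton := by
        rintro x ⟨hx, hx'⟩ y ⟨hy, -⟩
        rcases (hc.2 x hx y hy).eq_or_exists_isLink with h | ⟨e, z, he⟩
        · exact h
        · exact absurd he.inc_left (hx' e)
      exact (Set.ncard_le_one hs.finite).2 fun x hx y hy => hs hx hy
    rw [RotationSystem.faceCount, h1]
    omega

theorem RotationSystem.sameCycle_of_faceCount_le_one {G : Graph α β} (hG : G.IsFinite)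
    (R : G.RotationSystem) (h : R.faceCount ≤ 1) (d d' : G.Dart) : R.facePerm.SameCycle d d' := by
  have := hG.finite_dart
  have h1 : Nat.card (Quotient (SameCycle.setoid R.facePerm)) ≤ 1 :=
    (Nat.le_add_right _ _).trans h
  have := Finite.card_le_one_iff_subsingleton.1 h1
  exact Quotient.exact (Subsingleton.elim (Quotient.mk (SameCycle.setoid R.facePerm) d) ⟦d'⟧)

theorem card_quotient_sameCycle_le_one {D : Type*} (φ : Equiv.Perm D)
    (h : ∀ a b, φ.SameCycle a b) : Nat.card (Quotient (SameCycle.setoid φ)) ≤ 1 := by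
  have : Subsingleton (Quotient (SameCycle.setoid φ)) := ⟨fun x y => by
    induction x using Quotient.inductionOn
    induction y using Quotient.inductionOn
    exact Quotient.sound (h _ _)⟩
  exact Finite.card_le_one_iff_subsingleton.2 this

theorem card_quotient_sameCycle_le_two {D : Type*} (φ : Equiv.Perm D) (p q : D)
    (h : ∀ a, φ.SameCycle a p ∨ φ.SameCycle a q) :
    Nat.card (Quotient (SameCycle.setoid φ)) ≤ 2 := by
  have hsurj : Function.Surjective fun b : Bool =>
      (Quotient.mk (SameCycle.setoid φ) (if b then p else q)) := by
    intro x
    induction x using Quotient.inductionOn with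
    | h a =>
      rcases h a with h | h
      · exact ⟨true, Quotient.sound h.symm⟩
      · exact ⟨false, Quotient.sound h.symm⟩
  have := Nat.card_le_card_of_surjective _ hsurj
  simpa using this

/-- A rotation system of `A` from a permutation of a set into which the darts of `A` embed. -/
theorem exists_rotationSystem {A : Graph α β} {Y : Type*} [Finite Y] (ρ : Equiv.Perm Y) (o : Y → α)
    (ι : A.Dart → Y) (hι : Function.Injective ι)
    (hl : ∀ e : E(A), A.IsLink e (o (ι (e, false))) (o (ι (e, true))))
    (hs : ∀ d d', ρ.SameCycle (ι d) (ι d') ↔ o (ι d) = o (ι d')) :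
    ∃ R : A.RotationSystem, ∀ (a b : A.Dart) (n : ℕ), (ρ ^ (n + 1)) (ι a) = ι b →
        (∀ k < n, (ρ ^ (k + 1)) (ι a) ∉ Set.range ι) → R.rot a = b := by
  obtain ⟨τ, h1, h2⟩ := exists_firstReturn ρ ι hι
  exact ⟨⟨fun d => o (ι d), hl, τ, fun d d' => (h1 d d').trans (hs d d')⟩, h2⟩

/-! ### Reduction of one-face embeddings across the two-edge cut -/

namespace TwoSumData

variable {G G₁ G₂ : Graph α β} {e₁ e₂ f₁ f₂ : β} {a₁ b₁ a₂ b₂ : α}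

variable (D : TwoSumData G G₁ G₂ e₁ e₂ f₁ f₂ a₁ b₁ a₂ b₂)
include D

theorem mem_edgeSet_deleteVerts {X : Set α} {e : β} (he : e ∈ E(G₁.deleteVerts X)) (hne : e ≠ e₁) :
    e ∈ E(G.deleteVerts X) := by
  obtain ⟨x, y, h⟩ := exists_isLink_of_mem_edgeSet he
  rw [deleteVerts_isLink] at h
  refine IsLink.edge_mem (x := x) (y := y) ?_
  rw [deleteVerts_isLink]
  exact ⟨D.isLink_of_left h.1 hne, h.2⟩

/-- A dart of `G - X` with origin in `G₁` lies in `G₁ - X`, or is a dart of a new edge. -/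
theorem dart_cases {X : Set α} (R : (G.deleteVerts X).RotationSystem) (d : (G.deleteVerts X).Dart)
    (hd : R.org d ∈ V(G₁)) : ((d.1 : β) ∈ E(G₁.deleteVerts X) ∧ (d.1 : β) ≠ e₁) ∨
      ((d.1 : β) = f₁ ∧ R.org d = a₁) ∨ ((d.1 : β) = f₂ ∧ R.org d = b₁) := by
  obtain ⟨e, b⟩ := d
  have h := R.isLink_org e b
  rw [deleteVerts_isLink] at h
  rcases D.isLink_cases h.1 with ⟨h', hne⟩ | ⟨h', -⟩ | ⟨h', ⟨h'', -⟩ | ⟨h'', -⟩⟩ |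
    ⟨h', ⟨h'', -⟩ | ⟨h'', -⟩⟩
  · refine Or.inl ⟨IsLink.edge_mem (x := R.org (e, b)) (y := R.org (e, !b)) ?_, hne⟩
    rw [deleteVerts_isLink]
    exact ⟨h', h.2⟩
  · exact absurd h'.left_mem (D.notMem_right hd)
  · exact Or.inr (Or.inl ⟨h', h''⟩)
  · exact absurd hd (h'' ▸ D.notMem_left D.link₂.left_mem)
  · exact Or.inr (Or.inr ⟨h', h''⟩)
  · exact absurd hd (h'' ▸ D.notMem_left D.link₂.right_mem)

/-- The new edge `f₁` has only one dart with origin `a₁`. -/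
theorem dart_unique {X : Set α} (R : (G.deleteVerts X).RotationSystem)
    {d d' : (G.deleteVerts X).Dart} (hd : (d.1 : β) = f₁) (hd' : (d'.1 : β) = f₁)
    (h : R.org d = a₁) (h' : R.org d' = a₁) : d = d' := by
  obtain ⟨⟨e, he⟩, b⟩ := d
  obtain ⟨⟨e', he'⟩, b'⟩ := d'
  obtain rfl : e = f₁ := hd
  obtain rfl : e' = e := hd'
  by_cases hb : b' = b
  · rw [hb]
  have hb : b' = !b := by cases b <;> cases b' <;> simp_all
  subst hb
  have hl := R.isLink_org ⟨e', he⟩ b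
  rw [h, h', deleteVerts_isLink] at hl
  have := hl.1.right_unique D.isLink_f₁
  exact absurd (this ▸ D.link₂.left_mem) (D.notMem_right D.link₁.left_mem)

/-- If a one-face embedding of `G - X` is given and `X` avoids the ends of the two new edges, then
`G₁ - X` has an embedding with at most two faces. -/
theorem exists_rotationSystem_left (h₁ : G₁.IsFinite) (h₂ : G₂.IsFinite) {X : Set α} (ha₁ : a₁ ∉ X)
    (hb₁ : b₁ ∉ X) (ha₂ : a₂ ∉ X) (hb₂ : b₂ ∉ X) (R : (G.deleteVerts X).RotationSystem)
    (hR : ∀ d d', R.facePerm.SameCycle d d') :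
    ∃ R' : (G₁.deleteVerts X).RotationSystem,
      Nat.card (Quotient (SameCycle.setoid R'.facePerm)) ≤ 2 := by
  classical
  have hfin : Finite (G.deleteVerts X).Dart := by
    have : (G.deleteVerts X).IsFinite :=
      ⟨(D.isFinite h₁ h₂).1.subset deleteVerts_le.1, (D.isFinite h₁ h₂).2.subset
        (IsSubgraph.edgeSet_mono deleteVerts_le)⟩
    exact this.finite_dart
  have hf₁ : (G.deleteVerts X).IsLink f₁ a₁ a₂ := by
    rw [deleteVerts_isLink]; exact ⟨D.isLink_f₁, ha₁, ha₂⟩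
  have hf₂ : (G.deleteVerts X).IsLink f₂ b₁ b₂ := by
    rw [deleteVerts_isLink]; exact ⟨D.isLink_f₂, hb₁, hb₂⟩
  have he₁ : (G₁.deleteVerts X).IsLink e₁ a₁ b₁ := by
    rw [deleteVerts_isLink]; exact ⟨D.link₁, ha₁, hb₁⟩
  obtain ⟨c₁, hc₁⟩ := R.exists_org_eq hf₁.inc_left
  obtain ⟨c₂, hc₂⟩ := R.exists_org_eq hf₂.inc_left
  -- The second side is replaced by e₁: its dart at a₁ takes the place of the dart of f₁ at a₁, and
  -- its dart at b₁ that of f₂ at b₁.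
  let ι : (G₁.deleteVerts X).Dart → (G.deleteVerts X).Dart := fun d =>
    if h : (d.1 : β) = e₁ then
      if d.2 then (⟨f₂, hf₂.edge_mem⟩, c₂) else (⟨f₁, hf₁.edge_mem⟩, c₁)
    else (⟨d.1, D.mem_edgeSet_deleteVerts d.1.2 h⟩, d.2)
  have hιne : ∀ (d : (G₁.deleteVerts X).Dart) (h : (d.1 : β) ≠ e₁),
      ι d = (⟨d.1, D.mem_edgeSet_deleteVerts d.1.2 h⟩, d.2) := fun d h => by simp [ι, h]
  let t₀ : (G₁.deleteVerts X).Dart := (⟨e₁, he₁.edge_mem⟩, false)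
  let t₁ : (G₁.deleteVerts X).Dart := (⟨e₁, he₁.edge_mem⟩, true)
  have hιt₀ : ι t₀ = (⟨f₁, hf₁.edge_mem⟩, c₁) := by simp [ι, t₀]
  have hιt₁ : ι t₁ = (⟨f₂, hf₂.edge_mem⟩, c₂) := by simp [ι, t₁]
  have ht : ∀ d : (G₁.deleteVerts X).Dart, (d.1 : β) = e₁ → d = t₀ ∨ d = t₁ := by
    rintro ⟨⟨e, he⟩, b⟩ rfl
    cases b
    · exact Or.inl rfl
    · exact Or.inr rfl
  have hmem : ∀ d : (G₁.deleteVerts X).Dart, (d.1 : β) ∈ E(G₁) := fun d =>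
    IsSubgraph.edgeSet_mono deleteVerts_le d.1.2
  have hιinj : Function.Injective ι := by
    intro d d' h
    by_cases hd : (d.1 : β) = e₁ <;> by_cases hd' : (d'.1 : β) = e₁
    · rcases ht d hd with rfl | rfl <;> rcases ht d' hd' with rfl | rfl
      · rfl
      · rw [hιt₀, hιt₁] at h
        exact absurd (congrArg (fun t => (t.1 : β)) h) D.f_ne
      · rw [hιt₀, hιt₁] at h
        exact absurd (congrArg (fun t => (t.1 : β)) h) D.f_ne.symm
      · rfl
    · exfalso
      rw [hιne d' hd'] at h
      rcases ht d hd with rfl | rfl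
      · rw [hιt₀] at h
        exact D.ne_f₁_of_mem_left (hmem d') (congrArg (fun t => (t.1 : β)) h).symm
      · rw [hιt₁] at h
        exact D.ne_f₂_of_mem_left (hmem d') (congrArg (fun t => (t.1 : β)) h).symm
    · exfalso
      rw [hιne d hd] at h
      rcases ht d' hd' with rfl | rfl
      · rw [hιt₀] at h
        exact D.ne_f₁_of_mem_left (hmem d) (congrArg (fun t => (t.1 : β)) h)
      · rw [hιt₁] at h
        exact D.ne_f₂_of_mem_left (hmem d) (congrArg (fun t => (t.1 : β)) h)
    · rw [hιne d hd, hιne d' hd'] at h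
      exact Prod.ext (Subtype.ext (congrArg (fun t => (t.1 : β)) h)) (congrArg (fun t => t.2) h :)
  -- All darts issuing from the first side are in the image, so the rotation at its vertices is
  -- inherited unchanged and first returns take a single step.
  have hrange : ∀ y, R.org y ∈ V(G₁) → y ∈ Set.range ι := by
    intro y hy
    rcases D.dart_cases R y hy with ⟨h, hne⟩ | ⟨h, h'⟩ | ⟨h, h'⟩
    · exact ⟨(⟨y.1, h⟩, y.2), hιne _ hne⟩
    · exact ⟨t₀, hιt₀.trans (D.dart_unique R rfl h hc₁ h')⟩
    · exact ⟨t₁, hιt₁.trans (D.flip.dart_unique R rfl h hc₂ h')⟩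
  have horg : ∀ d, (G₁.deleteVerts X).IsLink d.1 (R.org (ι d)) (R.org (ι ((G₁.deleteVerts X).dartRev d))) := by
    intro d
    by_cases hd : (d.1 : β) = e₁
    · rcases ht d hd with rfl | rfl
      · have : (G₁.deleteVerts X).dartRev t₀ = t₁ := rfl
        rw [this, hιt₀, hιt₁, hc₁, hc₂]
        exact he₁
      · have : (G₁.deleteVerts X).dartRev t₁ = t₀ := rfl
        rw [this, hιt₀, hιt₁, hc₁, hc₂]
        exact he₁.symm
    · rw [hιne d hd, hιne ((G₁.deleteVerts X).dartRev d) hd]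
      obtain ⟨x, y, hxy⟩ := exists_isLink_of_mem_edgeSet d.1.2
      have h1 := R.isLink_org ⟨d.1, D.mem_edgeSet_deleteVerts d.1.2 hd⟩ d.2
      rw [deleteVerts_isLink] at hxy h1 ⊢
      have h2 := D.isLink_of_left hxy.1 hd
      refine ⟨?_, h1.2⟩
      rcases h1.1.eq_and_eq_or_eq_and_eq h2 with ⟨h3, h4⟩ | ⟨h3, h4⟩
      · rw [h3]; erw [h4]; exact hxy.1
      · rw [h3]; erw [h4]; exact hxy.1.symm
  obtain ⟨R', hR'⟩ := exists_rotationSystem (A := G₁.deleteVerts X) R.rot R.org ι hιinj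
    (fun e : E(_) => horg (e, false)) (fun d d' => R.sameCycle_iff _ _)
  have hface : ∀ d, (d.1 : β) ≠ e₁ → R.facePerm (ι d) = ι (R'.facePerm d) := by
    intro d hd
    have h1 : (G.deleteVerts X).dartRev (ι d) = ι ((G₁.deleteVerts X).dartRev d) := by
      rw [hιne d hd, hιne ((G₁.deleteVerts X).dartRev d) hd]; rfl
    obtain ⟨b, hb⟩ := hrange (R.facePerm (ι d)) (by
      rw [R.facePerm_apply, R.org_rot, h1]
      exact deleteVerts_le.1 (horg d).right_mem)
    rw [← hb]
    congr 1
    refine (hR' _ _ 0 ?_ (by simp)).symm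
    rw [hb, R.facePerm_apply, h1]
    rfl
  refine ⟨R', card_quotient_sameCycle_le_two _ t₀ t₁ fun d => ?_⟩
  -- The two face permutations agree up to the first dart of e₁. Since the single face of R reaches
  -- t₀, every face of R' runs into t₀ or, possibly earlier, into t₁.
  obtain ⟨k, hk⟩ := (hR (ι d) (ι t₀)).exists_nat_pow_eq
  induction k generalizing d with
  | zero =>
    rw [hιinj (by simpa using hk : ι d = ι t₀)]
    exact Or.inl (SameCycle.refl _ _)
  | succ k ih =>
    by_cases hd : (d.1 : β) = e₁
    · rcases ht d hd with rfl | rfl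
      · exact Or.inl (SameCycle.refl _ _)
      · exact Or.inr (SameCycle.refl _ _)
    · rw [pow_succ, Equiv.Perm.mul_apply, hface d hd] at hk
      exact (ih _ hk).imp sameCycle_apply_left.1 sameCycle_apply_left.1

/-- If a one-face embedding of `G - X` is given in which `f₂` is a bridge, then `G₁ - X` has a
one-face embedding. -/
theorem exists_rotationSystem_left_of_bridge (h₁ : G₁.IsFinite) (h₂ : G₂.IsFinite) {X : Set α}
    (ha₁ : a₁ ∈ X) (hb₁ : b₁ ∉ X) (hb₂ : b₂ ∉ X) (R : (G.deleteVerts X).RotationSystem)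
    (hR : ∀ d d', R.facePerm.SameCycle d d') :
    ∃ R' : (G₁.deleteVerts X).RotationSystem,
      Nat.card (Quotient (SameCycle.setoid R'.facePerm)) ≤ 1 := by
  classical
  have hfin : Finite (G.deleteVerts X).Dart := by
    have : (G.deleteVerts X).IsFinite :=
      ⟨(D.isFinite h₁ h₂).1.subset deleteVerts_le.1, (D.isFinite h₁ h₂).2.subset
        (IsSubgraph.edgeSet_mono deleteVerts_le)⟩
    exact this.finite_dart
  have hf₂ : (G.deleteVerts X).IsLink f₂ b₁ b₂ := by
    rw [deleteVerts_isLink]; exact ⟨D.isLink_f₂, hb₁, hb₂⟩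
  obtain ⟨c₂, hc₂⟩ := R.exists_org_eq hf₂.inc_left
  set m : (G.deleteVerts X).Dart := (⟨f₂, hf₂.edge_mem⟩, c₂) with hm
  have hne : ∀ d : (G₁.deleteVerts X).Dart, (d.1 : β) ≠ e₁ := by
    intro d hd
    obtain ⟨x, y, hxy⟩ := exists_isLink_of_mem_edgeSet d.1.2
    rw [deleteVerts_isLink, hd] at hxy
    rcases hxy.1.eq_and_eq_or_eq_and_eq D.link₁ with ⟨rfl, -⟩ | ⟨-, rfl⟩
    · exact hxy.2.1 ha₁
    · exact hxy.2.2 ha₁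
  let ι : (G₁.deleteVerts X).Dart → (G.deleteVerts X).Dart := fun d =>
    (⟨d.1, D.mem_edgeSet_deleteVerts d.1.2 (hne d)⟩, d.2)
  have hιinj : Function.Injective ι := fun d d' h =>
    Prod.ext (Subtype.ext (congrArg (fun t => (t.1 : β)) h)) (congrArg (fun t => t.2) h :)
  have hrange : ∀ y, R.org y ∈ V(G₁) → y ≠ m → y ∈ Set.range ι := by
    intro y hy hym
    rcases D.dart_cases R y hy with ⟨h, hne⟩ | ⟨h, h'⟩ | ⟨h, h'⟩
    · exact ⟨(⟨y.1, h⟩, y.2), rfl⟩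
    · have := R.isLink_org y.1 y.2
      rw [h, deleteVerts_isLink] at this
      exact absurd (h' ▸ ha₁) this.2.1
    · exact absurd (D.flip.dart_unique R h rfl h' hc₂) hym
  have horg : ∀ d, (G₁.deleteVerts X).IsLink d.1 (R.org (ι d))
      (R.org (ι ((G₁.deleteVerts X).dartRev d))) := by
    intro d
    obtain ⟨x, y, hxy⟩ := exists_isLink_of_mem_edgeSet d.1.2
    have h1 := R.isLink_org ⟨d.1, D.mem_edgeSet_deleteVerts d.1.2 (hne d)⟩ d.2
    rw [deleteVerts_isLink] at hxy h1 ⊢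
    have h2 := D.isLink_of_left hxy.1 (hne d)
    refine ⟨?_, h1.2⟩
    rcases h1.1.eq_and_eq_or_eq_and_eq h2 with ⟨h3, h4⟩ | ⟨h3, h4⟩
    · rw [h3]; erw [h4]; exact hxy.1
    · rw [h3]; erw [h4]; exact hxy.1.symm
  obtain ⟨R', hR'⟩ := exists_rotationSystem (A := G₁.deleteVerts X) R.rot R.org ι hιinj
    (fun e : E(_) => horg (e, false)) (fun d d' => R.sameCycle_iff _ _)
  have hface : ∀ d, R.facePerm (ι d) ≠ m → R.facePerm (ι d) = ι (R'.facePerm d) := by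
    intro d hd
    obtain ⟨b, hb⟩ := hrange (R.facePerm (ι d)) (by
      rw [R.facePerm_apply, R.org_rot]
      exact deleteVerts_le.1 (horg d).right_mem) hd
    rw [← hb]
    congr 1
    refine (hR' _ _ 0 ?_ (by simp)).symm
    rw [hb, R.facePerm_apply]
    rfl
  -- The single face of R has to leave the first side through m. Up to that point R' follows it, so
  -- each face of R' contains a dart followed in R by m. As m has only one predecessor, there is
  -- only one such face.
  have hex : ∀ d, ∃ d', R'.facePerm.SameCycle d d' ∧ R.facePerm (ι d') = m := by
    intro d
    obtain ⟨k, hk⟩ := (hR (ι d) m).exists_nat_pow_eq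
    induction k generalizing d with
    | zero =>
      exfalso
      have h : ι d = m := by simpa using hk
      exact D.ne_f₂_of_mem_left (IsSubgraph.edgeSet_mono deleteVerts_le d.1.2)
        (congrArg (fun t => (t.1 : β)) h)
    | succ k ih =>
      by_cases hd : R.facePerm (ι d) = m
      · exact ⟨d, SameCycle.refl _ _, hd⟩
      · rw [pow_succ, Equiv.Perm.mul_apply, hface d hd] at hk
        obtain ⟨d', h1, h2⟩ := ih _ hk
        exact ⟨d', sameCycle_apply_left.1 h1, h2⟩
  refine ⟨R', card_quotient_sameCycle_le_one _ fun d d' => ?_⟩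
  obtain ⟨u, h1, h2⟩ := hex d
  obtain ⟨u', h1', h2'⟩ := hex d'
  have : u = u' := hιinj (R.facePerm.injective (h2.trans h2'.symm))
  exact h1.trans (this ▸ h1'.symm)

end TwoSumData

end Graph

namespace Graph

variable {α β : Type*}

/-! ### Tightness of two-sums -/

theorem IsFinite.deleteVerts {G : Graph α β} (h : G.IsFinite) (X : Set α) :
    (G.deleteVerts X).IsFinite :=
  ⟨h.1.subset deleteVerts_le.1, h.2.subset (IsSubgraph.edgeSet_mono deleteVerts_le)⟩

theorem edgeSet_deleteVerts_pair (G : Graph α β) (x y : α) :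
    E(G.deleteVerts {x, y}) = E(G) \ (G.incidenceSet x ∪ G.incidenceSet y) := by
  ext e
  constructor
  · intro h
    obtain ⟨u, v, h⟩ := exists_isLink_of_mem_edgeSet h
    rw [deleteVerts_isLink] at h
    obtain ⟨h, hu, hv⟩ := h
    simp only [Set.mem_insert_iff, Set.mem_singleton_iff, not_or] at hu hv
    refine ⟨h.edge_mem, ?_⟩
    rintro (hx | hx)
    · rcases Inc.eq_or_eq_of_isLink hx h with h' | h'
      · exact hu.1 h'.symm
      · exact hv.1 h'.symm
    · rcases Inc.eq_or_eq_of_isLink hx h with h' | h'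
      · exact hu.2 h'.symm
      · exact hv.2 h'.symm
  · rintro ⟨he, hn⟩
    obtain ⟨u, v, h⟩ := exists_isLink_of_mem_edgeSet he
    refine IsLink.edge_mem (x := u) (y := v) ?_
    rw [deleteVerts_isLink]
    simp only [Set.mem_union, mem_incidenceSet, not_or] at hn
    simp only [Set.mem_insert_iff, Set.mem_singleton_iff, not_or]
    refine ⟨h, ⟨?_, ?_⟩, ?_, ?_⟩ <;> rintro rfl
    · exact hn.1 h.inc_left
    · exact hn.2 h.inc_left
    · exact hn.1 h.inc_right
    · exact hn.2 h.inc_right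

/-- Deleting two vertices joined by exactly one edge from a loopless cubic graph. -/
theorem IsCubic.ncard_edgeSet_deleteVerts_pair {G : Graph α β} (hc : G.IsCubic)
    (hl : ∀ e x, ¬ G.IsLink e x x) {x y : α} {e : β} (he : ∀ f, G.IsLink f x y ↔ f = e) :
    E(G.deleteVerts {x, y}).ncard + 5 = E(G).ncard := by
  have hxy : G.IsLink e x y := (he e).2 rfl
  have hfx : (G.incidenceSet x).Finite := hc.1.2.subset (G.incidenceSet_subset_edgeSet x)
  have hfy : (G.incidenceSet y).Finite := hc.1.2.subset (G.incidenceSet_subset_edgeSet y)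
  have hsub : G.incidenceSet x ∪ G.incidenceSet y ⊆ E(G) :=
    Set.union_subset (G.incidenceSet_subset_edgeSet x) (G.incidenceSet_subset_edgeSet y)
  have hinter : G.incidenceSet x ∩ G.incidenceSet y = {e} := by
    ext f
    constructor
    · rintro ⟨⟨u, hu⟩, hy⟩
      rcases Inc.eq_or_eq_of_isLink hy hu with h | h
      · exact absurd (h ▸ hxy) (hl e y)
      · exact (he f).1 (h ▸ hu)
    · rintro rfl
      exact ⟨hxy.inc_left, hxy.inc_right⟩
  -- The vertices have 3 edges each and share one: 3 + 3 − 1 = 5.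
  have h1 := Set.ncard_union_add_ncard_inter _ _ hfx hfy
  rw [hinter, Set.ncard_singleton, hc.ncard_incidenceSet hl hxy.left_mem,
    hc.ncard_incidenceSet hl hxy.right_mem] at h1
  have h2 := Set.ncard_sdiff_add_ncard_of_subset hsub hc.1.2
  rw [edgeSet_deleteVerts_pair]
  omega

theorem ncard_vertexSet_deleteVerts_pair {G : Graph α β} (hG : G.IsFinite) {x y : α}
    (hx : x ∈ V(G)) (hy : y ∈ V(G)) (hne : x ≠ y) :
    V(G.deleteVerts {x, y}).ncard + 2 = V(G).ncard := by
  have hsub : {x, y} ⊆ V(G) := by rintro z (rfl | rfl) <;> assumption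
  have := Set.ncard_sdiff_add_ncard_of_subset hsub hG.1
  rw [Set.ncard_pair hne] at this
  rw [vertexSet_deleteVerts]
  exact this

namespace TwoSumData

variable {G G₁ G₂ : Graph α β} {e₁ e₂ f₁ f₂ : β} {a₁ b₁ a₂ b₂ : α}

variable (D : TwoSumData G G₁ G₂ e₁ e₂ f₁ f₂ a₁ b₁ a₂ b₂)
include D

/-- Contraction of the second side of a `2`-sum preserves connectedness. -/
theorem isConnected_left {x y : α} (hx : x ∈ V(G₁)) (hy : y ∈ V(G₁))
    (hb : b₁ ∉ ({x, y} : Set α)) (hc : (G.deleteVerts {x, y}).IsConnected) :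
    (G₁.deleteVerts {x, y}).IsConnected := by
  classical
  have hV₂ : ∀ z ∈ V(G₂), z ∉ ({x, y} : Set α) := by
    rintro z hz (rfl | rfl)
    · exact D.notMem_left hz hx
    · exact D.notMem_left hz hy
  refine ⟨⟨b₁, ?_⟩, ?_⟩
  · rw [vertexSet_deleteVerts]
    exact ⟨D.link₁.right_mem, hb⟩
  intro u hu v hv
  rw [vertexSet_deleteVerts] at hu hv
  have huv := hc.2 u ⟨D.vertexSet_eq ▸ Or.inl hu.1, hu.2⟩ v ⟨D.vertexSet_eq ▸ Or.inl hv.1, hv.2⟩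
  -- The second side is collapsed to b₁, which has not been deleted. Then f₂ shrinks to a point, and
  -- f₁, if present, becomes e₁.
  have := huv.map (H := G₁.deleteVerts {x, y}) (fun z => if z ∈ V(G₁) then z else b₁) ?_
  · simpa [hu.1, hv.1] using this
  intro e s t hst
  rw [deleteVerts_isLink] at hst
  have hf : ∀ (s t : α), s ∈ V(G₁) → t ∉ V(G₁) → s ∉ ({x, y} : Set α) → G.IsLink e s t →
      (G₁.deleteVerts {x, y}).Reachable s b₁ := by
    intro s t hs ht hsX h
    rcases D.isLink_cases h with ⟨h, -⟩ | ⟨h, -⟩ | ⟨-, ⟨rfl, -⟩ | ⟨rfl, -⟩⟩ | ⟨-, ⟨rfl, -⟩ | ⟨rfl, -⟩⟩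
    · exact absurd h.right_mem ht
    · exact absurd h.left_mem (D.notMem_right hs)
    · refine IsLink.reachable (e := e₁) ?_
      rw [deleteVerts_isLink]
      exact ⟨D.link₁, hsX, hb⟩
    · exact absurd hs (D.notMem_left D.link₂.left_mem)
    · exact .refl _ _
    · exact absurd hs (D.notMem_left D.link₂.right_mem)
  by_cases hs : s ∈ V(G₁) <;> by_cases ht : t ∈ V(G₁)
  · simp only [hs, ht, if_true]
    refine IsLink.reachable (e := e) ?_
    rw [deleteVerts_isLink]
    exact ⟨(D.isLink_left hst.1 hs ht).1, hst.2⟩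
  · simp only [hs, ht, if_true, if_false]
    exact hf s t hs ht hst.2.1 hst.1
  · simp only [hs, ht, if_true, if_false]
    exact (hf t s ht hs hst.2.2 hst.1.symm).symm
  · simp only [hs, ht, if_false]
    exact .refl _ _

/-- A removable pair within the first side is removable in the first graph, provided that it does
not contain `b₁`. -/
theorem isRemovablePair_left (c₁ : G₁.IsCubic) (t₁ : G₁.IsTwoConnected) (h₂ : G₂.IsFinite)
    {x y : α} (hne : x ≠ y) {e : β} (he : ∀ f, G.IsLink f x y ↔ f = e) (hx : x ∈ V(G₁))
    (hy : y ∈ V(G₁)) (hb : b₁ ∉ ({x, y} : Set α)) (hc : (G.deleteVerts {x, y}).IsConnected)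
    (R : (G.deleteVerts {x, y}).RotationSystem) (hR : ∀ d d', R.facePerm.SameCycle d d') :
    G₁.IsRemovablePair x y := by
  have hV₂ : ∀ z ∈ V(G₂), z ∉ ({x, y} : Set α) := by
    rintro z hz (rfl | rfl)
    · exact D.notMem_left hz hx
    · exact D.notMem_left hz hy
  have he' : ∀ f, G₁.IsLink f x y ↔ f = e := by
    intro f
    constructor
    · intro h
      refine (he f).1 (D.isLink_of_left h ?_)
      -- An edge e₁ between x and y would put b₁ into the pair.
      rintro rfl
      rcases D.link₁.right_eq_or_eq h with h | h <;> simp [h] at hb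
    · rintro rfl
      exact (D.isLink_left ((he f).2 rfl) hx hy).1
  have hc' := D.isConnected_left hx hy hb hc
  refine ⟨hne, ⟨e, he', t₁.not_isBridge c₁ he'⟩, hc', ?_⟩
  by_cases ha : a₁ ∈ ({x, y} : Set α)
  · obtain ⟨R', hR'⟩ := D.exists_rotationSystem_left_of_bridge c₁.1 h₂ ha hb
      (hV₂ _ D.link₂.right_mem) R hR
    exact ⟨R', R'.faceCount_le hc' (by norm_num) (hR'.trans (by norm_num))⟩
  · obtain ⟨R', hR'⟩ := D.exists_rotationSystem_left c₁.1 h₂ ha hb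
      (hV₂ _ D.link₂.left_mem) (hV₂ _ D.link₂.right_mem) R hR
    exact ⟨R', R'.faceCount_le hc' (by norm_num) hR'⟩

/-- The ends of `e₁` do not form a removable pair of the `2`-sum. -/
theorem not_isConnected_deleteVerts (c₁ : G₁.IsCubic) (hl₁ : ∀ e x, ¬ G₁.IsLink e x x)
    {e : β} (he : ∀ f, G.IsLink f a₁ b₁ ↔ f = e) : ¬ (G.deleteVerts {a₁, b₁}).IsConnected := by
  intro hc
  have hel := D.isLink_left ((he e).2 rfl) D.link₁.left_mem D.link₁.right_mem
  have h3 := c₁.ncard_incidenceSet hl₁ D.link₁.left_mem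
  -- The third edge at a₁ leads to a vertex of G₁ outside the pair. That vertex is cut off from a₂,
  -- because deleting a₁ and b₁ destroys both new edges.
  have hex : ∃ g ∈ G₁.incidenceSet a₁, g ∉ ({e₁, e} : Set β) := by
    by_contra hcon
    push Not at hcon
    have h := Set.ncard_le_ncard (show G₁.incidenceSet a₁ ⊆ {e₁, e} from hcon)
    have := Set.ncard_insert_le e₁ {e}
    rw [Set.ncard_singleton] at this
    omega
  obtain ⟨g, ⟨z, hg⟩, hge⟩ := hex
  simp only [Set.mem_insert_iff, Set.mem_singleton_iff, not_or] at hge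
  have hza : z ≠ a₁ := fun h => hl₁ g a₁ (h ▸ hg)
  have hzb : z ≠ b₁ := fun h => hge.2 ((he g).1 (D.isLink_of_left (h ▸ hg) hge.1))
  have hV₂ : ∀ w ∈ V(G₂), w ∉ ({a₁, b₁} : Set α) := by
    rintro w hw (rfl | rfl)
    · exact D.notMem_left hw D.link₁.left_mem
    · exact D.notMem_left hw D.link₁.right_mem
  have hreach := hc.2 z (by
    rw [vertexSet_deleteVerts, D.vertexSet_eq]
    exact ⟨Or.inl hg.right_mem, by simp [hza, hzb]⟩) a₂ (by
    rw [vertexSet_deleteVerts, D.vertexSet_eq]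
    exact ⟨Or.inr D.link₂.left_mem, hV₂ _ D.link₂.left_mem⟩)
  have hstay : ∀ w, (G.deleteVerts {a₁, b₁}).Reachable z w → w ∈ V(G₁) := by
    intro w hw
    induction hw with
    | refl => exact hg.right_mem
    | tail _ hadj ih =>
      obtain ⟨f, hf⟩ := hadj
      rw [deleteVerts_isLink] at hf
      rcases D.isLink_cases hf.1 with ⟨h, -⟩ | ⟨h, -⟩ | ⟨-, ⟨rfl, -⟩ | ⟨-, rfl⟩⟩ |
        ⟨-, ⟨rfl, -⟩ | ⟨-, rfl⟩⟩
      · exact h.right_mem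
      · exact absurd h.left_mem (D.notMem_right ih)
      · exact absurd hf.2.1 (by simp)
      · exact D.link₁.left_mem
      · exact absurd hf.2.1 (by simp)
      · exact D.link₁.right_mem
  exact D.notMem_right (hstay _ hreach) D.link₂.left_mem

/-- If the pair misses b₁ or, after a flip, a₁, it would be removable in G₁. If it contains both,
its deletion disconnects G. -/
theorem false_of_removable_left (c₁ : G₁.IsCubic) (hl₁ : ∀ e x, ¬ G₁.IsLink e x x)
    (t₁ : G₁.IsTwoConnected) (h₂ : G₂.IsFinite)
    (hn : ∀ x y, ¬ G₁.IsRemovablePair x y)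
    {x y : α} (hne : x ≠ y) {e : β} (he : ∀ f, G.IsLink f x y ↔ f = e) (hx : x ∈ V(G₁))
    (hy : y ∈ V(G₁)) (hc : (G.deleteVerts {x, y}).IsConnected)
    (R : (G.deleteVerts {x, y}).RotationSystem) (hR : ∀ d d', R.facePerm.SameCycle d d') :
    False := by
  by_cases hb : b₁ ∈ ({x, y} : Set α)
  · by_cases ha : a₁ ∈ ({x, y} : Set α)
    · have hcases : (x = a₁ ∧ y = b₁) ∨ (x = b₁ ∧ y = a₁) := by
        have := D.ne₁
        simp only [Set.mem_insert_iff, Set.mem_singleton_iff] at ha hb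
        grind
      rcases hcases with ⟨rfl, rfl⟩ | ⟨rfl, rfl⟩
      · exact D.not_isConnected_deleteVerts c₁ hl₁ he hc
      · exact D.flip.not_isConnected_deleteVerts c₁ hl₁ he hc
    · exact hn x y (D.flip.isRemovablePair_left c₁ t₁ h₂ hne he hx hy ha hc R hR)
  · exact hn x y (D.isRemovablePair_left c₁ t₁ h₂ hne he hx hy hb hc R hR)

/-- The ends of a new edge do not form a removable pair. -/
theorem false_of_removable_f₁ (c₁ : G₁.IsCubic) (hl₁ : ∀ e x, ¬ G₁.IsLink e x x)
    (t₁ : G₁.IsTwoConnected) (h₂ : G₂.IsFinite) (heven : Even (V(G₁).ncard + E(G₁).ncard))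
    (R : (G.deleteVerts {a₁, a₂}).RotationSystem) (hR : ∀ d d', R.facePerm.SameCycle d d') :
    False := by
  have ha₂ : a₂ ∉ V(G₁) := D.notMem_left D.link₂.left_mem
  have hb₁ : b₁ ∉ ({a₁, a₂} : Set α) := by
    rintro (h | h)
    · exact D.ne₁ h.symm
    · exact ha₂ (h ▸ D.link₁.right_mem)
  have hb₂ : b₂ ∉ ({a₁, a₂} : Set α) := by
    rintro (h | h)
    · exact D.notMem_left D.link₂.right_mem (h ▸ D.link₁.left_mem)
    · exact D.ne₂ h.symm
  have hb₁' : b₁ ∈ V(G₁.deleteVerts {a₁, a₂}) := by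
    rw [vertexSet_deleteVerts]; exact ⟨D.link₁.right_mem, hb₁⟩
  obtain ⟨R', hR'⟩ := D.exists_rotationSystem_left_of_bridge c₁.1 h₂ (X := {a₁, a₂}) (by simp) hb₁
    hb₂ R hR
  have hconn : (G₁.deleteVerts {a₁, a₂}).IsConnected := by
    refine ⟨⟨b₁, hb₁'⟩, fun x hx y hy => ?_⟩
    rw [vertexSet_deleteVerts] at hx hy
    have hxa : x ≠ a₁ := fun h => hx.2 (Or.inl h)
    have hya : y ≠ a₁ := fun h => hy.2 (Or.inl h)
    have hr : (G₁.deleteVerts {a₁}).Reachable x y := by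
      by_contra hcon
      exact t₁.2 a₁ ⟨D.link₁.left_mem, Or.inl ⟨x, hx.1, y, hy.1, hxa, hya, hcon⟩⟩
    refine hr.mono fun e u v h => ?_
    rw [deleteVerts_isLink] at h ⊢
    refine ⟨h.1, ?_, ?_⟩
    · rintro (hu | hu)
      · exact h.2.1 hu
      · exact ha₂ (hu ▸ h.1.left_mem)
    · rintro (hu | hu)
      · exact h.2.2 hu
      · exact ha₂ (hu ▸ h.1.right_mem)
  -- This embedding of G₁ − a₁ has exactly one face. But one vertex and three edges have been lost,
  -- so |V| + |E| is still even and the number of faces must be even.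
  have h1 := R'.faceCount_le hconn le_rfl hR'
  have h2 := R'.faceCount_pos (c₁.1.deleteVerts _) ⟨b₁, hb₁'⟩
  have h3 := R'.even_faceCount_add (c₁.1.deleteVerts _)
  have hV : V(G₁.deleteVerts {a₁, a₂}).ncard + 1 = V(G₁).ncard := by
    have : V(G₁.deleteVerts {a₁, a₂}) = V(G₁) \ {a₁} := by
      rw [vertexSet_deleteVerts]
      ext z
      simp only [Set.mem_sdiff, Set.mem_insert_iff, Set.mem_singleton_iff, not_or]
      exact ⟨fun h => ⟨h.1, h.2.1⟩, fun h => ⟨h.1, h.2, fun hz => ha₂ (hz ▸ h.1)⟩⟩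
    rw [this]
    exact Set.ncard_sdiff_singleton_add_one D.link₁.left_mem c₁.1.1
  have hE : E(G₁.deleteVerts {a₁, a₂}).ncard + 3 = E(G₁).ncard := by
    have hempty : G₁.incidenceSet a₂ = ∅ := by
      ext e
      simp only [mem_incidenceSet, Set.mem_empty_iff_false, iff_false]
      exact fun h => ha₂ h.vertex_mem
    rw [edgeSet_deleteVerts_pair, hempty, Set.union_empty,
      ← c₁.ncard_incidenceSet hl₁ D.link₁.left_mem]
    exact Set.ncard_sdiff_add_ncard_of_subset (G₁.incidenceSet_subset_edgeSet a₁) c₁.1.2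
  obtain ⟨p, hp⟩ := heven
  obtain ⟨q, hq⟩ := h3
  omega

/-- The edge joining the pair lies in G₁ − e₁ or in G₂ − e₂, or it is one of f₁ and f₂; each case is
excluded once the embedding of the rest is known to have a single face. -/
theorem not_isRemovablePair (c₁ : G₁.IsCubic) (c₂ : G₂.IsCubic) (t₁ : G₁.IsTwoConnected)
    (t₂ : G₂.IsTwoConnected)
    (hn₁ : ∀ x y, ¬ G₁.IsRemovablePair x y) (hn₂ : ∀ x y, ¬ G₂.IsRemovablePair x y)
    (hev₁ : Even (V(G₁).ncard + E(G₁).ncard)) (hev₂ : Even (V(G₂).ncard + E(G₂).ncard)) (x y : α) :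
    ¬ G.IsRemovablePair x y := by
  rintro ⟨hne, ⟨e, he, -⟩, hc, R, hR⟩
  have hl₁ := t₁.loopless c₁
  have hl₂ := t₂.loopless c₂
  have hcub := D.isCubic c₁ c₂ hl₁ hl₂
  have hxy : G.IsLink e x y := (he e).2 rfl
  -- |V| + |E| drops by 2 + 5 = 7 and becomes odd, so an embedding with at most two faces has
  -- exactly one.
  have hR1 : ∀ d d', R.facePerm.SameCycle d d' := by
    refine R.sameCycle_of_faceCount_le_one (hcub.1.deleteVerts _) ?_
    have h1 := R.even_faceCount_add (hcub.1.deleteVerts _)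
    have h2 := hcub.ncard_edgeSet_deleteVerts_pair (D.loopless hl₁ hl₂) he
    have h3 := ncard_vertexSet_deleteVerts_pair hcub.1 hxy.left_mem hxy.right_mem hne
    have h4 := D.ncard_vertexSet c₁.1 c₂.1
    have h5 := D.ncard_edgeSet c₁.1 c₂.1
    obtain ⟨p, hp⟩ := h1
    obtain ⟨q, hq⟩ := hev₁
    obtain ⟨r, hr⟩ := hev₂
    omega
  rcases D.isLink_cases hxy with ⟨h, -⟩ | ⟨h, -⟩ | ⟨-, ⟨rfl, rfl⟩ | ⟨rfl, rfl⟩⟩ |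
      ⟨-, ⟨rfl, rfl⟩ | ⟨rfl, rfl⟩⟩
  · exact D.false_of_removable_left c₁ hl₁ t₁ c₂.1 hn₁ hne he h.left_mem h.right_mem hc R hR1
  · exact D.swap.false_of_removable_left c₂ hl₂ t₂ c₁.1 hn₂ hne he h.left_mem h.right_mem hc R hR1
  · exact D.false_of_removable_f₁ c₁ hl₁ t₁ c₂.1 hev₁ R hR1
  · exact D.swap.false_of_removable_f₁ c₂ hl₂ t₂ c₁.1 hev₂ R hR1
  · exact D.flip.false_of_removable_f₁ c₁ hl₁ t₁ c₂.1 hev₁ R hR1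
  · exact D.swap.flip.false_of_removable_f₁ c₂ hl₂ t₂ c₁.1 hev₂ R hR1

end TwoSumData

end Graph

namespace Graph

variable {α β : Type*}

/-! ### Orientations with even in-degrees -/

open Classical in
/-- The in-degree modulo `2` of `u` when each edge `e ∈ F` points to `h e`. -/
noncomputable def inDegreeParity (F : Finset β) (h : β → α) (u : α) : ZMod 2 :=
  ∑ e ∈ F, if h e = u then 1 else 0

open Classical in
theorem inDegreeParity_eq (F : Finset β) (h : β → α) (u : α) :
    inDegreeParity F h u = ((({e | e ∈ F ∧ h e = u} : Set β).ncard : ℕ) : ZMod 2) := by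
  rw [inDegreeParity, Finset.sum_boole, ← Set.ncard_coe_finset]
  congr 2
  ext e
  simp

open Classical in
theorem inDegreeParity_update {F : Finset β} {h : β → α} {e : β} (he : e ∈ F) (z u : α) :
    inDegreeParity F (Function.update h e z) u =
      inDegreeParity F h u + (if h e = u then 1 else 0) + (if z = u then 1 else 0) := by
  unfold inDegreeParity
  rw [← Finset.add_sum_erase _ _ he, ← Finset.add_sum_erase F (fun x => if h x = u then _ else _) he]
  have h1 : ∑ x ∈ F.erase e, (if Function.update h e z x = u then (1 : ZMod 2) else 0) =
      ∑ x ∈ F.erase e, if h x = u then 1 else 0 :=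
    Finset.sum_congr rfl fun x hx => by
      rw [Function.update_of_ne (Finset.ne_of_mem_erase hx)]
  have h2 : (if h e = u then (1 : ZMod 2) else 0) + (if h e = u then 1 else 0) = 0 :=
    CharTwo.add_self_eq_zero _
  rw [h1, Function.update_self]
  linear_combination (-1 : ZMod 2) * h2

open Classical in
/-- Reversing the edges of a walk changes the in-degree parities exactly at its two ends. -/
theorem Reachable.exists_flip {H : Graph α β} {F : Finset β} (hF : ∀ e, e ∈ F ↔ e ∈ E(H))
    {v w : α} (hvw : H.Reachable v w) (h : β → α) (hh : ∀ e ∈ E(H), H.Inc e (h e)) :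
    ∃ h' : β → α, (∀ e ∈ E(H), H.Inc e (h' e)) ∧ ∀ u, inDegreeParity F h' u =
      inDegreeParity F h u + (if v = u then 1 else 0) + (if w = u then 1 else 0) := by
  induction hvw with
  | refl =>
    refine ⟨h, hh, fun u => ?_⟩
    rw [add_assoc, CharTwo.add_self_eq_zero, add_zero]
  | @tail w z _ hadj ih =>
    obtain ⟨h', h1, h2⟩ := ih
    obtain ⟨e, he⟩ := hadj
    have heF : e ∈ F := (hF e).2 he.edge_mem
    have hcan : ∀ u, (if w = u then (1 : ZMod 2) else 0) + (if w = u then 1 else 0) = 0 :=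
      fun u => CharTwo.add_self_eq_zero _
    have hcan' : ∀ u, (if z = u then (1 : ZMod 2) else 0) + (if z = u then 1 else 0) = 0 :=
      fun u => CharTwo.add_self_eq_zero _
    have hval : ∀ t, H.Inc e t → ∀ e' ∈ E(H), H.Inc e' (Function.update h' e t e') := by
      intro t ht e' he'
      by_cases hee : e' = e
      · subst hee
        rw [Function.update_self]
        exact ht
      · rw [Function.update_of_ne hee]
        exact h1 _ he'
    -- Whichever end e points to, turning it around toggles the parities at both w and z; the change
    -- at w cancels the one made before.
    rcases (h1 e he.edge_mem).eq_or_eq_of_isLink he with hw | hz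
    · refine ⟨Function.update h' e z, hval z he.inc_right, fun u => ?_⟩
      rw [inDegreeParity_update heF, h2, hw]
      linear_combination hcan u
    · refine ⟨Function.update h' e w, hval w he.inc_left, fun u => ?_⟩
      rw [inDegreeParity_update heF, h2, hz]
      linear_combination hcan u

theorem mem_componentEdges_iff {H : Graph α β} {v : α} {e : β} {y : α} (he : H.Inc e y) :
    e ∈ H.componentEdges v ↔ H.Reachable v y := by
  constructor
  · rintro ⟨z, hvz, hz⟩
    obtain ⟨t, ht⟩ := hz
    rcases he.eq_or_eq_of_isLink ht with rfl | rfl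
    · exact hvz
    · exact hvz.trans ht.reachable
  · exact fun h => ⟨y, h, he⟩

theorem Reachable.componentEdges_eq {H : Graph α β} {v w : α} (h : H.Reachable v w) :
    H.componentEdges v = H.componentEdges w := by
  ext e
  exact ⟨fun ⟨y, h1, h2⟩ => ⟨y, h.symm.trans h1, h2⟩, fun ⟨y, h1, h2⟩ => ⟨y, h.trans h1, h2⟩⟩

open Classical in
/-- The edges of a component are counted by the in-degrees of its vertices. -/
theorem sum_inDegreeParity {H : Graph α β} {F : Finset β} (hF : ∀ e, e ∈ F ↔ e ∈ E(H))
    {W : Finset α} (hW : ∀ x, x ∈ W ↔ x ∈ V(H)) (h : β → α) (hh : ∀ e ∈ E(H), H.Inc e (h e))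
    (v : α) : ∑ w ∈ W with H.Reachable v w, inDegreeParity F h w =
      ((H.componentEdges v).ncard : ZMod 2) := by
  have hcomp : H.componentEdges v = ↑(F.filter fun e => H.Reachable v (h e)) := by
    ext e
    simp only [Finset.coe_filter, Set.mem_ofPred_eq]
    constructor
    · intro he
      have heE : e ∈ E(H) := by
        obtain ⟨y, -, hy⟩ := he
        exact hy.edge_mem
      exact ⟨(hF e).2 heE, (mem_componentEdges_iff (hh e heE)).1 he⟩
    · rintro ⟨he, hr⟩
      exact (mem_componentEdges_iff (hh e ((hF e).1 he))).2 hr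
  rw [hcomp, Set.ncard_coe_finset]
  unfold inDegreeParity
  rw [Finset.sum_comm, ← Finset.sum_boole]
  refine Finset.sum_congr rfl fun e he => ?_
  have hmem : h e ∈ W := (hW _).2 (hh e ((hF e).1 he)).vertex_mem
  rw [Finset.sum_ite_eq]
  simp [hmem]

open Classical in
/-- Each edge can be assigned to one of its ends in such a way that odd in-degrees only occur in
components with an odd number of edges. -/
theorem exists_orientation_odd [Nonempty α] {H : Graph α β} {F : Finset β} (hF : ∀ e, e ∈ F ↔ e ∈ E(H))
    {W : Finset α} (hW : ∀ x, x ∈ W ↔ x ∈ V(H)) :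
    ∃ h : β → α, (∀ e ∈ E(H), H.Inc e (h e)) ∧
      ∀ v ∈ V(H), inDegreeParity F h v ≠ 0 → Odd (H.componentEdges v).ncard := by
  have key : ∀ (n : ℕ) (h : β → α), (∀ e ∈ E(H), H.Inc e (h e)) →
      (W.filter fun v => inDegreeParity F h v ≠ 0).card = n →
      ∃ h : β → α, (∀ e ∈ E(H), H.Inc e (h e)) ∧
      ∀ v ∈ V(H), inDegreeParity F h v ≠ 0 → Odd (H.componentEdges v).ncard := by
    intro n
    induction n using Nat.strong_induction_on with
    | _ n ih =>
      intro h hh hn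
      by_cases hall : ∀ v ∈ V(H), inDegreeParity F h v ≠ 0 → Odd (H.componentEdges v).ncard
      · exact ⟨h, hh, hall⟩
      push Not at hall
      obtain ⟨v, hv, hv1, hev⟩ := hall
      -- The in-degrees in a component sum to its number of edges. In an even component a vertex of
      -- odd in-degree therefore has a companion, and turning around the edges of a walk between the
      -- two repairs both.
      have hex : ∃ w ∈ V(H), H.Reachable v w ∧ w ≠ v ∧ inDegreeParity F h w ≠ 0 := by
        by_contra hcon
        push Not at hcon
        have hsum := sum_inDegreeParity hF hW h hh v
        rw [Finset.sum_eq_single v] at hsum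
        · rw [hsum] at hv1
          exact hv1 (by
            rw [ZMod.natCast_eq_zero_iff_even]
            exact Nat.not_odd_iff_even.1 hev)
        · intro w hw hwv
          rw [Finset.mem_filter] at hw
          exact hcon w ((hW w).1 hw.1) hw.2 hwv
        · intro hnot
          exact absurd (Finset.mem_filter.2 ⟨(hW v).2 hv, .refl _ _⟩) hnot
      obtain ⟨w, hw, hvw, hne, hw1⟩ := hex
      obtain ⟨h', h1, h2⟩ := hvw.exists_flip hF h hh
      have hone : ∀ x : ZMod 2, x ≠ 0 → x = 1 := by decide
      have hsub : (W.filter fun v => inDegreeParity F h' v ≠ 0) ⊂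
          (W.filter fun v => inDegreeParity F h v ≠ 0) := by
        rw [Finset.ssubset_iff_of_subset]
        · refine ⟨v, Finset.mem_filter.2 ⟨(hW v).2 hv, hv1⟩, ?_⟩
          rw [Finset.mem_filter, not_and_not_right]
          intro _
          rw [h2, hone _ hv1]
          simp [hne]
          decide
        · intro u hu
          rw [Finset.mem_filter] at hu ⊢
          refine ⟨hu.1, ?_⟩
          by_cases huv : v = u
          · exact huv ▸ hv1
          by_cases huw : w = u
          · exact huw ▸ hw1
          have := hu.2
          rw [h2] at this
          simpa [huv, huw] using this
      exact ih _ (hn ▸ Finset.card_lt_card hsub) h' h1 rfl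
  have hex : ∀ e, ∃ x, e ∈ E(H) → H.Inc e x := by
    intro e
    by_cases he : e ∈ E(H)
    · obtain ⟨x, y, hxy⟩ := exists_isLink_of_mem_edgeSet he
      exact ⟨x, fun _ => hxy.inc_left⟩
    · exact ⟨Classical.arbitrary α, fun h => absurd h he⟩
  choose h hh using hex
  exact key _ h hh rfl

open Classical in
/-- If `{e₁}` is the only odd component, the other edges can be assigned to their ends with even
in-degrees. -/
theorem exists_even_orientation {H : Graph α β} (hfin : H.IsFinite) {e₁ : β}
    (hodd : H.oddComponents = {{e₁}}) :
    e₁ ∈ E(H) ∧ ∃ h : β → α, (∀ e ∈ E(H), H.Inc e (h e)) ∧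
      ∀ v, Even {e | e ∈ E(H) \ {e₁} ∧ h e = v}.ncard := by
  obtain ⟨x, hx, hxe, -⟩ : {e₁} ∈ H.oddComponents := hodd ▸ rfl
  have he₁ : e₁ ∈ H.componentEdges x := hxe ▸ rfl
  obtain ⟨y, hxy, hy⟩ := he₁
  have : Nonempty α := ⟨x⟩
  obtain ⟨h, h1, h2⟩ := exists_orientation_odd (H := H) (F := hfin.2.toFinset)
    (W := hfin.1.toFinset) (by simp) (by simp)
  refine ⟨hy.edge_mem, h, h1, fun v => ?_⟩
  have hfinv : {e | e ∈ E(H) ∧ h e = v}.Finite := hfin.2.subset fun e he => he.1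
  have hset : {e | e ∈ E(H) \ {e₁} ∧ h e = v} = {e | e ∈ E(H) ∧ h e = v} \ {e₁} := by
    ext e
    simp only [Set.mem_ofPred_eq, Set.mem_sdiff, Set.mem_singleton_iff]
    tauto
  rw [hset]
  have hcomp : v ∈ V(H) → H.componentEdges v = {e₁} → {e | e ∈ E(H) ∧ h e = v} ⊆ {e₁} := by
    rintro hv hc e ⟨he, rfl⟩
    rw [← hc]
    exact ⟨h e, .refl _ _, h1 e he⟩
  -- At the head of e₁ no other edge of the component exists, so discarding e₁ leaves in-degree 0.
  -- At any other vertex v an odd in-degree would place v in an odd component, which can only be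
  -- that of e₁, and make e₁ point to v.
  by_cases hm : e₁ ∈ {e | e ∈ E(H) ∧ h e = v}
  · have hv : v ∈ V(H) := hm.2 ▸ (h1 e₁ hm.1).vertex_mem
    have hc : H.componentEdges v = {e₁} := by
      have : H.Reachable x v :=
        (mem_componentEdges_iff (hm.2 ▸ h1 e₁ hm.1)).1 (hxe ▸ rfl)
      rw [← this.componentEdges_eq, ← hxe]
    have := Set.sdiff_eq_empty.2 (hcomp hv hc)
    rw [this]
    simp
  · rw [Set.sdiff_singleton_eq_self hm]
    by_contra hodd'
    have hne : {e | e ∈ E(H) ∧ h e = v}.Nonempty := by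
      rw [Set.nonempty_iff_ne_empty]
      intro h0
      rw [h0] at hodd'
      simp at hodd'
    obtain ⟨e, he⟩ := hne
    have hv : v ∈ V(H) := he.2 ▸ (h1 e he.1).vertex_mem
    have hoddc := h2 v hv (by
      rw [inDegreeParity_eq]
      simp only [Set.Finite.mem_toFinset]
      rw [Ne, ZMod.natCast_eq_zero_iff_even]
      exact hodd')
    have hmem : H.componentEdges v ∈ H.oddComponents := ⟨v, hv, rfl, hoddc⟩
    rw [hodd, Set.mem_singleton_iff] at hmem
    have := hcomp hv hmem he
    rw [Set.mem_singleton_iff] at this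
    exact hm (this ▸ he)

end Graph

/-! ### Rotations on part of the darts -/

namespace Equiv.Perm

variable {D : Type*} {α : Type*}

theorem SameCycle.mem_iff {φ : Perm D} {A : Set D} (hA : ∀ a, a ∈ A ↔ φ a ∈ A) {a b : D}
    (h : φ.SameCycle a b) : a ∈ A ↔ b ∈ A :=
  h.of_step (r := fun a b => a ∈ A ↔ b ∈ A)
    ⟨fun _ => Iff.rfl, fun h => h.symm, fun h h' => h.trans h'⟩ hA

/-- The cycle of a point that is swapped with another one. -/
theorem SameCycle.eq_or_eq_of_swapped {φ : Perm D} {d d' y : D} (h1 : φ d = d') (h2 : φ d' = d)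
    (h : φ.SameCycle d y) : y = d ∨ y = d' := by
  refine (h.mem_iff (A := {d, d'}) fun a => ?_).1 (by simp)
  simp only [Set.mem_insert_iff, Set.mem_singleton_iff]
  constructor
  · rintro (rfl | rfl)
    · exact Or.inr h1
    · exact Or.inl h2
  · rintro (h | h)
    · exact Or.inr (φ.injective (h.trans h2.symm))
    · exact Or.inl (φ.injective (h.trans h1.symm))

variable [DecidableEq D] [Finite D]

/-- `ρ` fixes the points outside `Z`, and its cycles on `Z` are the fibres of `o`. -/
structure IsRotationOn (o : D → α) (Z : Set D) (ρ : Perm D) : Prop where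
  apply_of_notMem : ∀ y, y ∉ Z → ρ y = y
  sameCycle_iff : ∀ y ∈ Z, ∀ y' ∈ Z, ρ.SameCycle y y' ↔ o y = o y'

omit [DecidableEq D] [Finite D] in
theorem IsRotationOn.apply_mem {o : D → α} {Z : Set D} {ρ : Perm D} (h : IsRotationOn o Z ρ)
    {y : D} (hy : y ∈ Z) : ρ y ∈ Z ∧ o (ρ y) = o y := by
  have hm : ρ y ∈ Z := by
    by_contra hn
    have := ρ.injective (h.apply_of_notMem _ hn)
    rw [this] at hn
    exact hn hy
  exact ⟨hm, (h.sameCycle_iff _ hm _ hy).1 (sameCycle_apply_left.2 (SameCycle.refl _ _))⟩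

/-- Insertion of the point `d` into a rotation, right before `y` is passed to its successor. -/
theorem IsRotationOn.insert {o : D → α} {Z : Set D} {ρ : Perm D} (h : IsRotationOn o Z ρ) {y d : D}
    (hy : y ∈ Z) (hd : d ∉ Z) (ho : o d = o y) :
    IsRotationOn o (insert d Z) (ρ * swap y d) := by
  -- Since d is still a fixed point, the transposition merges the cycle {d} with the cycle of y.
  have hfix : ρ d = d := h.apply_of_notMem d hd
  have hdy : ∀ z, ρ.SameCycle z d ↔ z = d := fun z =>
    ⟨fun hz => hz.eq_of_right hfix, fun hz => hz ▸ SameCycle.refl _ _⟩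
  have hnot : ¬ ρ.SameCycle y d := fun hc => hd ((hdy y).1 hc ▸ hy)
  constructor
  · intro z hz
    rw [Set.mem_insert_iff, not_or] at hz
    rw [mul_apply, swap_apply_of_ne_of_ne (fun e => hz.2 (by rw [e]; exact hy)) hz.1, h.apply_of_notMem z hz.2]
  · intro a ha b hb
    rw [sameCycle_mul_swap_iff hnot, hdy, hdy]
    have hne : ∀ z ∈ Z, z ≠ d := fun z hz e => hd (e ▸ hz)
    have hcd : ∀ z, ρ.SameCycle d z ↔ z = d := fun z => sameCycle_comm.trans (hdy z)
    rcases ha with rfl | ha <;> rcases hb with rfl | hb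
    · simp [SameCycle.refl]
    · simp [hcd, hne b hb, hne y hy, h.sameCycle_iff b hb y hy, ho, eq_comm]
    · simp [hdy, hne a ha, h.sameCycle_iff a ha y hy, ho]
    · simp only [hne a ha, hne b hb, or_false, h.sameCycle_iff a ha b hb, h.sameCycle_iff a ha y hy,
        h.sameCycle_iff b hb y hy]
      exact ⟨fun h => h.elim id fun h => h.1.trans h.2.symm, Or.inl⟩

end Equiv.Perm

namespace Graph

open Equiv Equiv.Perm

variable {α β : Type*} {G : Graph α β}

/-! ### Rotations with a marker at each vertex -/

/-- The darts of `G`, together with one marker for each vertex. -/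
abbrev MarkedDart (G : Graph α β) : Type _ := G.Dart ⊕ V(G)

theorem IsFinite.finite_markedDart (h : G.IsFinite) : Finite G.MarkedDart := by
  have := h.finite_dart
  have := h.1.to_subtype
  infer_instance

/-- The reversal of darts; the markers are fixed. -/
def markedRev (G : Graph α β) : Perm G.MarkedDart := Equiv.sumCongr G.dartRev (Equiv.refl _)

/-- The vertex of a dart or marker. -/
def markedOrg (o : G.Dart → α) : G.MarkedDart → α := Sum.elim o Subtype.val

/-- All markers, and the darts of the edges in `S`. -/
def markedZone (G : Graph α β) (S : Set β) : Set G.MarkedDart :=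
  {y | ∀ d, y = Sum.inl d → (d.1 : β) ∈ S}

@[simp]
theorem inl_mem_markedZone {S : Set β} {d : G.Dart} :
    (Sum.inl d : G.MarkedDart) ∈ G.markedZone S ↔ (d.1 : β) ∈ S := by
  constructor
  · exact fun h => h d rfl
  · intro h d' hd'
    rw [← Sum.inl.inj hd']
    exact h

@[simp]
theorem inr_mem_markedZone {S : Set β} {v : V(G)} :
    (Sum.inr v : G.MarkedDart) ∈ G.markedZone S := by
  simp [markedZone]

theorem markedZone_insert (S : Set β) (e : E(G)) (b : Bool) :
    G.markedZone (insert (e : β) S) =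
      insert (Sum.inl (e, !b)) (insert (Sum.inl (e, b)) (G.markedZone S)) := by
  ext y
  rcases y with ⟨e', b'⟩ | v
  · simp only [inl_mem_markedZone, Set.mem_insert_iff, Sum.inl.injEq, Prod.mk.injEq, Subtype.ext_iff]
    cases b <;> cases b' <;> simp
  · simp

/-- A rotation `ρ` of the subgraph with vertex set `C` and edge set `S` that has only one face. -/
structure IsOneFaceOn (o : G.Dart → α) (C : Set α) (S : Set β) (ρ : Perm G.MarkedDart) : Prop where
  rotation : IsRotationOn (markedOrg o) (G.markedZone S) ρ
  org_mem : ∀ d : G.Dart, (d.1 : β) ∈ S → o d ∈ C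
  sameCycle : ∀ y ∈ G.markedZone S, markedOrg o y ∈ C → ∀ y' ∈ G.markedZone S, markedOrg o y' ∈ C →
    (ρ * G.markedRev).SameCycle y y'

/-- The starting point of the construction: without edges every marker is a rotation by itself, and
the one marker at r is the only face. -/
theorem IsOneFaceOn.singleton (o : G.Dart → α) (r : α) : IsOneFaceOn o {r} ∅ 1 where
  rotation := by
    constructor
    · intro y _; rfl
    · rintro (d | v) hv (d' | v') hv'
      · simp at hv
      · simp at hv
      · simp at hv'
      · simp [markedOrg, Subtype.ext_iff]
  org_mem d hd := by simp at hd
  sameCycle := by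
    rintro (d | v) hv hv₁ (d' | v') hv' hv₁'
    · simp at hv
    · simp at hv
    · simp at hv'
    · have : v = v' := Subtype.ext ((Set.mem_singleton_iff.1 hv₁).trans
        (Set.mem_singleton_iff.1 hv₁').symm)
      rw [this]

@[simp]
theorem markedRev_inl (d : G.Dart) : G.markedRev (Sum.inl d) = Sum.inl (d.1, !d.2) := rfl

@[simp]
theorem markedRev_inr (v : V(G)) : G.markedRev (Sum.inr v) = Sum.inr v := rfl

theorem markedRev_markedRev (y : G.MarkedDart) : G.markedRev (G.markedRev y) = y := by
  rcases y with ⟨e, b⟩ | v <;> simp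

/-- The face permutation exchanges the two darts of an edge outside the subgraph. -/
theorem facePerm_apply_of_notMem {o : G.Dart → α} {S : Set β} {ρ : Perm G.MarkedDart}
    (h : IsRotationOn (markedOrg o) (G.markedZone S) ρ) {e : E(G)} (he : (e : β) ∉ S) (b : Bool) :
    (ρ * G.markedRev) (Sum.inl (e, b)) = Sum.inl (e, !b) := by
  rw [Perm.mul_apply, markedRev_inl]
  exact h.apply_of_notMem _ (by simpa using he)

theorem sameCycle_of_notMem {o : G.Dart → α} {S : Set β} {ρ : Perm G.MarkedDart}
    (h : IsRotationOn (markedOrg o) (G.markedZone S) ρ) {e : E(G)} (he : (e : β) ∉ S) (b : Bool) :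
    (ρ * G.markedRev).SameCycle (Sum.inl (e, b)) (Sum.inl (e, !b)) := by
  rw [← facePerm_apply_of_notMem h he b]
  exact sameCycle_apply_right.2 (SameCycle.refl _ _)

/-- As ρ fixes both darts of an edge not yet added, the face permutation just exchanges them. Such
an edge forms a separate two-element cycle, to be merged into the others when the edge is added. -/
theorem SameCycle.eq_inl_or_eq_inl {o : G.Dart → α} {S : Set β} {ρ : Perm G.MarkedDart}
    (h : IsRotationOn (markedOrg o) (G.markedZone S) ρ) {e : E(G)} (he : (e : β) ∉ S) {b : Bool}
    {y : G.MarkedDart} (hy : (ρ * G.markedRev).SameCycle y (Sum.inl (e, b))) :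
    y = Sum.inl (e, b) ∨ y = Sum.inl (e, !b) :=
  hy.symm.eq_or_eq_of_swapped (facePerm_apply_of_notMem h he b)
    (by simpa using facePerm_apply_of_notMem h he (!b))

variable [DecidableEq G.MarkedDart]

/-- Moving the transpositions past the reversal conjugates them by it. Inserting an edge into the
rotation thus multiplies the face permutation by two transpositions, whose effect on cycles is
known. -/
theorem mul_swap_mul_markedRev (ρ : Perm G.MarkedDart) (x y d d' : G.MarkedDart) :
    ρ * swap x d * swap y d' * G.markedRev = ρ * G.markedRev *
      swap (G.markedRev x) (G.markedRev d) * swap (G.markedRev y) (G.markedRev d') := by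
  have hinv : (G.markedRev)⁻¹ = G.markedRev := by
    ext1 y
    rw [Perm.inv_eq_iff_eq, markedRev_markedRev]
  have h : ∀ p q : G.MarkedDart, swap p q * G.markedRev =
      G.markedRev * swap (G.markedRev p) (G.markedRev q) := by
    intro p q
    rw [swap_mul_eq_mul_swap, hinv]
  rw [mul_assoc, h, ← mul_assoc, mul_assoc ρ, h]
  simp only [mul_assoc]

variable [Finite G.MarkedDart]

/-- The two darts of the edge are inserted one after the other, directly after x and y; the choice
of these corners decides what happens to the faces. -/
theorem rotation_insert_edge {o : G.Dart → α} {S : Set β} {ρ : Perm G.MarkedDart}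
    (h : IsRotationOn (markedOrg o) (G.markedZone S) ρ) {e : E(G)} {b : Bool} (he : (e : β) ∉ S)
    {x y : G.MarkedDart} (hx : x ∈ G.markedZone S) (hy : y ∈ G.markedZone S)
    (hox : markedOrg o x = o (e, b)) (hoy : markedOrg o y = o (e, !b)) :
    IsRotationOn (markedOrg o) (G.markedZone (insert (e : β) S))
      (ρ * swap x (Sum.inl (e, b)) * swap y (Sum.inl (e, !b))) := by
  rw [markedZone_insert S e b]
  refine (h.insert hx (by simpa using he) ?_).insert (Set.mem_insert_of_mem _ hy) ?_ ?_
  · exact hox.symm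
  · simp [he]
  · exact hoy.symm

/-- Addition of an edge to a new vertex. -/
theorem IsOneFaceOn.insert_leaf {o : G.Dart → α} {C : Set α} {S : Set β} {ρ : Perm G.MarkedDart}
    (h : IsOneFaceOn o C S ρ) {e : E(G)} {b : Bool} (hV : ∀ d, o d ∈ V(G)) (hu : o (e, b) ∈ C)
    (hv : o (e, !b) ∉ C) :
    ∃ ρ' : Perm G.MarkedDart, IsOneFaceOn o (insert (o (e, !b)) C) (insert (e : β) S) ρ' := by
  have he : (e : β) ∉ S := fun he => hv (h.org_mem (e, !b) he)
  set d : G.MarkedDart := Sum.inl (e, b) with hd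
  set d' : G.MarkedDart := Sum.inl (e, !b) with hd'
  set mu : G.MarkedDart := Sum.inr ⟨o (e, b), hV _⟩ with hmu
  set mv : G.MarkedDart := Sum.inr ⟨o (e, !b), hV _⟩ with hmv
  have hrev : G.markedRev d = d' := rfl
  have hrev' : G.markedRev d' = d := by simp [hd, hd']
  have hφ := mul_swap_mul_markedRev ρ mu mv d d'
  rw [hrev, hrev', hmu, hmv, markedRev_inr, markedRev_inr, ← hmu, ← hmv] at hφ
  set φ := ρ * G.markedRev with hφdef
  -- The new vertex has no edge yet, so its marker is a face of its own. Three cycles (the old face,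
  -- the two darts of e, the new marker) are then merged into one by two transpositions.
  have hfix : φ mv = mv := by
    rw [hφdef, Perm.mul_apply, hmv, markedRev_inr]
    obtain ⟨h1, h2⟩ := h.rotation.apply_mem (inr_mem_markedZone (S := S) (v := ⟨o (e, !b), hV _⟩))
    rcases hcase : ρ (Sum.inr ⟨o (e, !b), hV _⟩) with t | v
    · rw [hcase] at h1 h2
      have := h.org_mem t (by simpa using h1)
      exact absurd ((show o t = o (e, !b) from h2) ▸ this) hv
    · rw [hcase] at h2
      congr 1
      exact Subtype.ext h2
  have hmvd : mv ≠ d := by simp [hmv, hd]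
  have hmvd' : mv ≠ d' := by simp [hmv, hd']
  have hmumv : mu ≠ mv := by
    intro heq
    have hval : o (e, b) = o (e, !b) := congrArg Subtype.val (Sum.inr.inj heq)
    exact hv (hval ▸ hu)
  have hn1 : ¬ φ.SameCycle mu d' := fun hc => by
    rcases SameCycle.eq_inl_or_eq_inl h.rotation he hc with h | h <;> simp [hmu] at h
  have hn2 : ¬ (φ * swap mu d').SameCycle mv d := by
    rw [sameCycle_mul_swap_iff hn1]
    have hmvx : ∀ z, φ.SameCycle mv z → mv = z := fun z hz => hz.eq_of_left hfix
    rintro (hc | ⟨hc | hc, -⟩)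
    · exact hmvd (hmvx _ hc)
    · exact hmumv (hmvx _ hc).symm
    · exact hmvd' (hmvx _ hc)
  refine ⟨_, rotation_insert_edge h.rotation he (x := mu) (y := mv) inr_mem_markedZone
    inr_mem_markedZone rfl rfl, ?_, ?_⟩
  · rintro ⟨e', b'⟩ (ht | ht)
    · obtain rfl : e' = e := Subtype.ext ht
      by_cases hb : b' = b
      · subst hb; exact Or.inr hu
      · obtain rfl : b' = !b := by cases b <;> cases b' <;> simp_all
        exact Or.inl rfl
    · exact Or.inr (h.org_mem _ ht)
  · rw [hφ]
    have hstep1 : ∀ {a b}, φ.SameCycle a b → (φ * swap mu d' * swap mv d).SameCycle a b :=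
      fun hab => (sameCycle_mul_swap_iff hn2).2 (Or.inl ((sameCycle_mul_swap_iff hn1).2 (Or.inl hab)))
    have hmud' : (φ * swap mu d' * swap mv d).SameCycle mu d' :=
      (sameCycle_mul_swap_iff hn2).2 (Or.inl (sameCycle_mul_swap_self hn1))
    have hdd' : (φ * swap mu d' * swap mv d).SameCycle d d' :=
      hstep1 (sameCycle_of_notMem h.rotation he b)
    have hmvd : (φ * swap mu d' * swap mv d).SameCycle mv d := sameCycle_mul_swap_self hn2
    have key : ∀ y ∈ G.markedZone (insert (e : β) S), markedOrg o y ∈ insert (o (e, !b)) C →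
        (φ * swap mu d' * swap mv d).SameCycle y mu := by
      intro y hy hyC
      rw [markedZone_insert S e b] at hy
      rcases hy with rfl | rfl | hy
      · exact hmud'.symm
      · exact hdd'.trans hmud'.symm
      · rcases hyC with hyv | hyC
        · rcases y with t | v
          · have := h.org_mem t (by simpa using hy)
            exact absurd ((show o t = o (e, !b) from hyv) ▸ this) hv
          · have : (Sum.inr v : G.MarkedDart) = mv := congrArg Sum.inr (Subtype.ext hyv)
            rw [this]
            exact (hmvd.trans hdd').trans hmud'.symm
        · exact hstep1 (h.sameCycle y hy hyC mu inr_mem_markedZone hu)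
    exact fun y hy hyC y' hy' hyC' => (key y hy hyC).trans (key y' hy' hyC').symm

/-- Addition of an edge between two old vertices splits the face into two faces, both of which are
incident with the end of the edge. -/
theorem IsOneFaceOn.insert_edge {o : G.Dart → α} {C : Set α} {S : Set β} {ρ : Perm G.MarkedDart}
    (h : IsOneFaceOn o C S ρ) {e : E(G)} {b : Bool} (hV : ∀ d, o d ∈ V(G)) (he : (e : β) ∉ S)
    (hu : o (e, b) ∈ C) (hv : o (e, !b) ∈ C) :
    ∃ ρ' : Perm G.MarkedDart, IsRotationOn (markedOrg o) (G.markedZone (insert (e : β) S)) ρ' ∧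
      (∀ d : G.Dart, (d.1 : β) ∈ insert (e : β) S → o d ∈ C) ∧
      ¬ (ρ' * G.markedRev).SameCycle (Sum.inr ⟨o (e, !b), hV _⟩) (Sum.inl (e, b)) ∧
      ∀ y ∈ G.markedZone (insert (e : β) S), markedOrg o y ∈ C →
        (ρ' * G.markedRev).SameCycle y (Sum.inr ⟨o (e, !b), hV _⟩) ∨
        (ρ' * G.markedRev).SameCycle y (Sum.inl (e, b)) := by
  set d : G.MarkedDart := Sum.inl (e, b) with hd
  set d' : G.MarkedDart := Sum.inl (e, !b) with hd'
  set mu : G.MarkedDart := Sum.inr ⟨o (e, b), hV _⟩ with hmu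
  set mv : G.MarkedDart := Sum.inr ⟨o (e, !b), hV _⟩ with hmv
  have hrev : G.markedRev d = d' := rfl
  have hrev' : G.markedRev d' = d := by simp [hd, hd']
  have hφ := mul_swap_mul_markedRev ρ mu mv d d'
  rw [hrev, hrev', hmu, hmv, markedRev_inr, markedRev_inr, ← hmu, ← hmv] at hφ
  set φ := ρ * G.markedRev with hφdef
  have hmvd : mv ≠ d := by simp [hmv, hd]
  have hn1 : ¬ φ.SameCycle mu d' := fun hc => by
    rcases SameCycle.eq_inl_or_eq_inl h.rotation he hc with h | h <;> simp [hmu] at h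
  have hmono : ∀ {a b}, φ.SameCycle a b → (φ * swap mu d').SameCycle a b :=
    fun hab => (sameCycle_mul_swap_iff hn1).2 (Or.inl hab)
  have hdd' : (φ * swap mu d').SameCycle d d' :=
    hmono (sameCycle_of_notMem h.rotation he b)
  have hmumv : (φ * swap mu d').SameCycle mu mv :=
    hmono (h.sameCycle mu inr_mem_markedZone hu mv inr_mem_markedZone hv)
  have hmud' : (φ * swap mu d').SameCycle mu d' := sameCycle_mul_swap_self hn1
  -- The first transposition merges the two darts of e into the old face; now mv and d lie in the
  -- same cycle, and the second transposition splits it.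
  have hmvd1 : (φ * swap mu d').SameCycle mv d := (hmumv.symm.trans hmud').trans hdd'.symm
  refine ⟨_, rotation_insert_edge h.rotation he (x := mu) (y := mv) inr_mem_markedZone
    inr_mem_markedZone rfl rfl, ?_, ?_, ?_⟩
  · rintro ⟨e', b'⟩ (ht | ht)
    · obtain rfl : e' = e := Subtype.ext ht
      by_cases hb : b' = b
      · subst hb; exact hu
      · obtain rfl : b' = !b := by cases b <;> cases b' <;> simp_all
        exact hv
    · exact h.org_mem _ ht
  · rw [hφ]
    exact not_sameCycle_mul_swap hmvd hmvd1
  · rw [hφ]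
    intro y hy hyC
    have hy1 : (φ * swap mu d').SameCycle y mv := by
      rw [markedZone_insert S e b] at hy
      rcases hy with rfl | rfl | hy
      · exact hmud'.symm.trans hmumv
      · exact hmvd1.symm
      · exact hmono (h.sameCycle y hy hyC mv inr_mem_markedZone hv)
    rcases hy1.mul_swap mv d with h1 | ⟨h1, -⟩
    · exact Or.inl h1
    · exact h1

/-- Addition of two adjacent edges between old vertices. -/
theorem IsOneFaceOn.insert_pair {o : G.Dart → α} {C : Set α} {S : Set β} {ρ : Perm G.MarkedDart}
    (h : IsOneFaceOn o C S ρ) {e f : E(G)} {b c : Bool} (hV : ∀ d, o d ∈ V(G)) (he : (e : β) ∉ S)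
    (hf : (f : β) ∉ S) (hef : f ≠ e) (hu : o (e, b) ∈ C) (hv : o (e, !b) ∈ C)
    (hadj : o (f, c) = o (e, !b)) (hw : o (f, !c) ∈ C) :
    ∃ ρ' : Perm G.MarkedDart, IsOneFaceOn o C (insert (f : β) (insert (e : β) S)) ρ' := by
  obtain ⟨ρ₁, hrot, horg, hsplit, hcover⟩ := h.insert_edge hV he hu hv
  have hf' : (f : β) ∉ insert (e : β) S := by
    rw [Set.mem_insert_iff, not_or]
    exact ⟨fun h => hef (Subtype.ext h), hf⟩
  set mv : G.MarkedDart := Sum.inr ⟨o (e, !b), hV _⟩ with hmv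
  set mw : G.MarkedDart := Sum.inr ⟨o (f, !c), hV _⟩ with hmw
  set g : G.MarkedDart := Sum.inl (f, c) with hg
  set g' : G.MarkedDart := Sum.inl (f, !c) with hg'
  -- Both faces have a corner at the common end of e and f, one given by the marker mv, the other by
  -- the dart (e, !b). The corner is taken in the face not containing mw, so that f joins the two
  -- faces.
  have hcorner : ∃ x ∈ G.markedZone (insert (e : β) S), markedOrg o x = o (f, c) ∧
      ¬ (ρ₁ * G.markedRev).SameCycle (G.markedRev x) mw ∧
      (∀ t, G.markedRev x ≠ Sum.inl (f, t)) ∧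
      ∀ y ∈ G.markedZone (insert (e : β) S), markedOrg o y ∈ C →
        (ρ₁ * G.markedRev).SameCycle y (G.markedRev x) ∨ (ρ₁ * G.markedRev).SameCycle y mw := by
    by_cases hc : (ρ₁ * G.markedRev).SameCycle mw mv
    · refine ⟨Sum.inl (e, !b), by simp, hadj.symm, ?_, ?_, ?_⟩
      · simp only [markedRev_inl, Bool.not_not]
        exact fun h => hsplit (h.trans hc).symm
      · simp [hef.symm]
      · simp only [markedRev_inl, Bool.not_not]
        intro y hy hyC
        rcases hcover y hy hyC with h1 | h1
        · exact Or.inr (h1.trans hc.symm)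
        · exact Or.inl h1
    · refine ⟨mv, inr_mem_markedZone, hadj.symm, ?_, ?_, ?_⟩
      · rw [hmv, markedRev_inr]
        exact fun h => hc h.symm
      · simp [hmv]
      · rw [hmv, markedRev_inr]
        intro y hy hyC
        have hmwd := (hcover mw inr_mem_markedZone hw).resolve_left hc
        rcases hcover y hy hyC with h1 | h1
        · exact Or.inl h1
        · exact Or.inr (h1.trans hmwd.symm)
  obtain ⟨x, hxZ, hxo, hxw, hxne, hxcover⟩ := hcorner
  have hrev : G.markedRev g = g' := rfl
  have hrev' : G.markedRev g' = g := by simp [hg, hg']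
  have hφ := mul_swap_mul_markedRev ρ₁ x mw g g'
  rw [hrev, hrev', hmw, markedRev_inr, ← hmw] at hφ
  set p := G.markedRev x with hp
  set φ := ρ₁ * G.markedRev with hφdef
  have hn1 : ¬ φ.SameCycle p g' := fun hc => by
    rcases SameCycle.eq_inl_or_eq_inl hrot hf' hc with h | h
    · exact hxne _ h
    · exact hxne _ h
  have hnw : ∀ t, ¬ φ.SameCycle mw (Sum.inl (f, t)) := fun t hc => by
    rcases SameCycle.eq_inl_or_eq_inl hrot hf' hc with h | h <;> simp [hmw] at h
  have hn2 : ¬ (φ * swap p g').SameCycle mw g := by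
    rw [sameCycle_mul_swap_iff hn1]
    rintro (hc | ⟨hc | hc, -⟩)
    · exact hnw _ hc
    · exact hxw hc.symm
    · exact hnw _ hc
  refine ⟨_, rotation_insert_edge hrot hf' (x := x) (y := mw) hxZ inr_mem_markedZone hxo rfl, ?_, ?_⟩
  · rintro ⟨e', b'⟩ (ht | ht)
    · obtain rfl : e' = f := Subtype.ext ht
      by_cases hb : b' = c
      · subst hb; rw [hadj]; exact hv
      · obtain rfl : b' = !c := by cases c <;> cases b' <;> simp_all
        exact hw
    · exact horg _ ht
  · rw [hφ]
    have hstep : ∀ {a b}, φ.SameCycle a b → (φ * swap p g' * swap mw g).SameCycle a b :=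
      fun hab => (sameCycle_mul_swap_iff hn2).2 (Or.inl ((sameCycle_mul_swap_iff hn1).2 (Or.inl hab)))
    have hpg' : (φ * swap p g' * swap mw g).SameCycle p g' :=
      (sameCycle_mul_swap_iff hn2).2 (Or.inl (sameCycle_mul_swap_self hn1))
    have hgg' : (φ * swap p g' * swap mw g).SameCycle g g' :=
      hstep (sameCycle_of_notMem hrot hf' c)
    have hmwg : (φ * swap p g' * swap mw g).SameCycle mw g := sameCycle_mul_swap_self hn2
    have key : ∀ y ∈ G.markedZone (insert (f : β) (insert (e : β) S)), markedOrg o y ∈ C →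
        (φ * swap p g' * swap mw g).SameCycle y p := by
      intro y hy hyC
      rw [markedZone_insert _ f c] at hy
      rcases hy with rfl | rfl | hy
      · exact hpg'.symm
      · exact hgg'.trans hpg'.symm
      · rcases hxcover y hy hyC with h1 | h1
        · exact hstep h1
        · exact (((hstep h1).trans hmwg).trans hgg').trans hpg'.symm
    exact fun y hy hyC y' hy' hyC' => (key y hy hyC).trans (key y' hy' hyC').symm

end Graph

/-! ### Assembly of embeddings from trees and pairs of edges -/

namespace Graph

open Equiv Equiv.Perm

variable {α β : Type*} {G : Graph α β}

/-- `o` assigns to each dart its initial vertex. -/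
def IsOrigin (G : Graph α β) (o : G.Dart → α) : Prop :=
  ∀ (e : E(G)) (b : Bool), G.IsLink e (o (e, b)) (o (e, !b))

theorem exists_isOrigin (G : Graph α β) : ∃ o, G.IsOrigin o := by
  choose x y h using fun e : E(G) => exists_isLink_of_mem_edgeSet e.2
  refine ⟨fun d => if d.2 then x d.1 else y d.1, fun e b => ?_⟩
  cases b
  · simpa using (h e).symm
  · simpa using h e

theorem IsOrigin.mem {o : G.Dart → α} (ho : G.IsOrigin o) (d : G.Dart) : o d ∈ V(G) :=
  (ho d.1 d.2).left_mem

theorem IsOrigin.exists_eq {o : G.Dart → α} (ho : G.IsOrigin o) {e : E(G)} {x y : α}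
    (h : G.IsLink e x y) : ∃ b, o (e, b) = x ∧ o (e, !b) = y := by
  rcases (ho e true).eq_and_eq_or_eq_and_eq h with ⟨h1, h2⟩ | ⟨h1, h2⟩
  · exact ⟨true, h1, h2⟩
  · exact ⟨false, h2, h1⟩

variable [DecidableEq G.MarkedDart] [Finite G.MarkedDart]

theorem IsOneFaceOn.exists_insert_leaf {o : G.Dart → α} (ho : G.IsOrigin o) {C : Set α} {S : Set β}
    {ρ : Perm G.MarkedDart} (h : IsOneFaceOn o C S ρ) {e : β} {u v : α} (he : G.IsLink e u v)
    (hu : u ∈ C) (hv : v ∉ C) :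
    ∃ ρ' : Perm G.MarkedDart, IsOneFaceOn o (insert v C) (insert e S) ρ' := by
  obtain ⟨b, h1, h2⟩ := ho.exists_eq (e := ⟨e, he.edge_mem⟩) he
  rw [← h1] at hu
  rw [← h2] at hv ⊢
  exact h.insert_leaf (e := ⟨e, he.edge_mem⟩) ho.mem hu hv

/-- Addition of a tree that meets the old vertices in a single vertex. -/
theorem IsOneFaceOn.exists_union_tree {o : G.Dart → α} (ho : G.IsOrigin o) {C : Set α} {S : Set β}
    {ρ : Perm G.MarkedDart} (h : IsOneFaceOn o C S ρ) {T : Graph α β} (hT : T.IsTree)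
    (hfin : V(T).Finite) (hTG : ∀ e x y, T.IsLink e x y → G.IsLink e x y) {r : α} (hr : r ∈ V(T))
    (hrC : r ∈ C) (hC : ∀ v ∈ V(T), v ∈ C → v = r) :
    ∃ ρ' : Perm G.MarkedDart, IsOneFaceOn o (C ∪ V(T)) (S ∪ E(T)) ρ' := by
  suffices key : ∀ (n : ℕ) (K : Set α) (F : Set β) (ρ : Perm G.MarkedDart), (V(T) \ K).ncard = n →
      K ⊆ V(T) → r ∈ K → F ⊆ E(T) → (∀ v ∈ K, (T.restrict F).Reachable r v) →
      IsOneFaceOn o (C ∪ K) (S ∪ F) ρ →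
      ∃ ρ' : Perm G.MarkedDart, IsOneFaceOn o (C ∪ V(T)) (S ∪ E(T)) ρ' by
    refine key _ {r} ∅ ρ rfl (by simpa using hr) rfl (by simp) ?_ ?_
    · rintro v rfl; exact .refl _ _
    · rwa [Set.union_empty, Set.union_eq_self_of_subset_right (by simpa using hrC)]
  intro n
  induction n with
  | zero =>
    intro K F ρ hn hK hrK hF hreach hρ
    have hKV : K = V(T) := by
      refine hK.antisymm ?_
      rw [← Set.sdiff_eq_empty]
      exact (Set.ncard_eq_zero hfin.sdiff).1 hn
    -- Once all vertices are reached no edge of T can be missing: it is a bridge of T, yet its ends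
    -- are joined within F.
    have hFE : F = E(T) := by
      refine hF.antisymm fun e he => ?_
      by_contra heF
      obtain ⟨x, y, hxy, hb⟩ := hT.2 e he
      have hle : ∀ e' x y, (T.restrict F).IsLink e' x y → (T.deleteEdges {e}).IsLink e' x y := by
        intro e' x y h
        rw [restrict_isLink] at h
        rw [deleteEdges_isLink]
        refine ⟨h.2, ?_⟩
        rintro rfl
        exact heF h.1
      exact hb (((hreach x (hKV ▸ hxy.left_mem)).symm.trans
        (hreach y (hKV ▸ hxy.right_mem))).mono hle)
    rw [← hKV, ← hFE]
    exact ⟨ρ, hρ⟩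
  | succ n ih =>
    intro K F ρ hn hK hrK hF hreach hρ
    have hne : (V(T) \ K).Nonempty := by
      rw [← Set.ncard_pos hfin.sdiff]
      omega
    obtain ⟨v, hv, hvK⟩ := hne
    obtain ⟨e, x, y, hxy, hx, hy⟩ := hT.1.exists_isLink_boundary hr hrK hv hvK
    have hyC : y ∉ C ∪ K := by
      rintro (h | h)
      · exact hy (hC y hxy.right_mem h ▸ hrK)
      · exact hy h
    obtain ⟨ρ', hρ'⟩ := hρ.exists_insert_leaf ho (hTG _ _ _ hxy) (Or.inr hx) hyC
    rw [← Set.union_insert, ← Set.union_insert] at hρ'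
    refine ih (insert y K) (insert e F) ρ' ?_ (Set.insert_subset hxy.right_mem hK)
      (Set.mem_insert_of_mem _ hrK) (Set.insert_subset hxy.edge_mem hF) ?_ hρ'
    · have h1 : V(T) \ insert y K = (V(T) \ K) \ {y} := by
        ext z
        simp only [Set.mem_sdiff, Set.mem_insert_iff, Set.mem_singleton_iff]
        tauto
      have := Set.ncard_sdiff_singleton_add_one (show y ∈ V(T) \ K from ⟨hxy.right_mem, hy⟩)
        hfin.sdiff
      rw [h1]
      omega
    · have hle : ∀ e' x y, (T.restrict F).IsLink e' x y →
          (T.restrict (insert e F)).IsLink e' x y := by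
        intro e' x y h
        rw [restrict_isLink] at h ⊢
        exact ⟨Or.inr h.1, h.2⟩
      rintro z (rfl | hz)
      · refine ((hreach x hx).mono hle).trans (IsLink.reachable (e := e) ?_)
        rw [restrict_isLink]
        exact ⟨Or.inl rfl, hxy⟩
      · exact (hreach z hz).mono hle

/-- Addition of edges between old vertices that are oriented with even in-degrees. -/
theorem IsOneFaceOn.exists_union_pairs {o : G.Dart → α} (ho : G.IsOrigin o) {C : Set α}
    (h : β → α) (X : Set β) (hX : X.Finite) (hinc : ∀ e ∈ X, G.Inc e (h e))
    (hC : ∀ e ∈ X, ∀ x, G.Inc e x → x ∈ C) (heven : ∀ v, Even {e | e ∈ X ∧ h e = v}.ncard)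
    {S : Set β} (hXS : Disjoint X S) {ρ : Perm G.MarkedDart} (hρ : IsOneFaceOn o C S ρ) :
    ∃ ρ' : Perm G.MarkedDart, IsOneFaceOn o C (S ∪ X) ρ' := by
  obtain ⟨n, hn⟩ : ∃ n, X.ncard = n := ⟨_, rfl⟩
  induction n using Nat.strong_induction_on generalizing X S ρ with
  | _ n ih =>
    rcases X.eq_empty_or_nonempty with rfl | ⟨e, he⟩
    · exact ⟨ρ, by rwa [Set.union_empty]⟩
    have hfinv : ∀ v, {e | e ∈ X ∧ h e = v}.Finite := fun v => hX.subset fun e he => he.1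
    -- The in-degree at the head of e is even and not 0, so a second edge has the same head.
    have hex : ∃ f ∈ X, f ≠ e ∧ h f = h e := by
      by_contra hcon
      push Not at hcon
      have : {f | f ∈ X ∧ h f = h e} = {e} := by
        ext f
        simp only [Set.mem_ofPred_eq, Set.mem_singleton_iff]
        constructor
        · rintro ⟨h1, h2⟩
          by_contra hne
          exact hcon f h1 hne h2
        · rintro rfl
          exact ⟨he, rfl⟩
      have h2 := heven (h e)
      rw [this, Set.ncard_singleton] at h2
      simp at h2
    obtain ⟨f, hf, hfe, hhf⟩ := hex
    have hinc1 := hinc e he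
    have hinc2 := hinc f hf
    -- The edge e is read towards the common head and f away from it, as the insertion of a pair
    -- requires.
    obtain ⟨b, hb1, hb2⟩ := ho.exists_eq (e := ⟨e, hinc1.edge_mem⟩) hinc1.isLink_other.symm
    obtain ⟨c, hc1, hc2⟩ := ho.exists_eq (e := ⟨f, hinc2.edge_mem⟩) hinc2.isLink_other
    obtain ⟨ρ', hρ'⟩ := hρ.insert_pair (e := ⟨e, hinc1.edge_mem⟩) (f := ⟨f, hinc2.edge_mem⟩)
      (b := b) (c := c) ho.mem (Set.disjoint_left.1 hXS he) (Set.disjoint_left.1 hXS hf)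
      (fun h => hfe (congrArg Subtype.val h)) (hC e he _ (ho ⟨e, hinc1.edge_mem⟩ b).inc_left)
      (hC e he _ (ho ⟨e, hinc1.edge_mem⟩ b).inc_right) (by rw [hb2, hc1, hhf])
      (hC f hf _ (ho ⟨f, hinc2.edge_mem⟩ c).inc_right)
    have hXcard : (X \ {e, f}).ncard < n := by
      rw [← hn]
      exact Set.ncard_lt_ncard ⟨Set.sdiff_subset, fun hs => (hs he).2 (Or.inl rfl)⟩ hX
    have hevX : ∀ v, Even {g | g ∈ X \ {e, f} ∧ h g = v}.ncard := by
      intro v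
      by_cases hv : h e = v
      · have h1 : {g | g ∈ X \ {e, f} ∧ h g = v} = {g | g ∈ X ∧ h g = v} \ {e, f} := by
          ext g
          simp only [Set.mem_ofPred_eq, Set.mem_sdiff]
          tauto
        have hsub : {e, f} ⊆ {g | g ∈ X ∧ h g = v} := by
          rintro g (rfl | rfl)
          · exact ⟨he, hv⟩
          · exact ⟨hf, hhf.trans hv⟩
        have h2 := Set.ncard_sdiff_add_ncard_of_subset hsub (hfinv v)
        rw [Set.ncard_pair hfe.symm] at h2
        have h3 := heven v
        rw [← h2, ← h1] at h3
        exact (Nat.even_add.1 h3).2 even_two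
      · have h1 : {g | g ∈ X \ {e, f} ∧ h g = v} = {g | g ∈ X ∧ h g = v} := by
          ext g
          simp only [Set.mem_ofPred_eq, Set.mem_sdiff, Set.mem_insert_iff, Set.mem_singleton_iff]
          constructor
          · exact fun h => ⟨h.1.1, h.2⟩
          · rintro ⟨hg, rfl⟩
            refine ⟨⟨hg, ?_⟩, rfl⟩
            rintro (rfl | rfl)
            · exact hv rfl
            · exact hv hhf.symm
        rw [h1]
        exact heven v
    have hdisj : Disjoint (X \ {e, f}) (insert f (insert e S)) := by
      rw [Set.disjoint_left]
      rintro g ⟨hg, hn⟩ (rfl | rfl | h)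
      · exact hn (Or.inr rfl)
      · exact hn (Or.inl rfl)
      · exact Set.disjoint_left.1 hXS hg h
    obtain ⟨ρ'', hρ''⟩ := ih _ hXcard (X \ {e, f}) hX.sdiff (fun e he => hinc e he.1)
      (fun e he => hC e he.1) hevX hdisj hρ' rfl
    refine ⟨ρ'', ?_⟩
    have : insert f (insert e S) ∪ X \ {e, f} = S ∪ X := by
      ext g
      simp only [Set.mem_union, Set.mem_insert_iff, Set.mem_sdiff, Set.mem_singleton_iff, not_or]
      constructor
      · rintro ((rfl | rfl | h) | h)
        · exact Or.inr hf
        · exact Or.inr he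
        · exact Or.inl h
        · exact Or.inr h.1
      · tauto
    rwa [this] at hρ''

/-- Addition of a graph `K - e₁` meeting the old vertices in a single vertex, where `e₁` is an odd
edge of `K`. -/
theorem IsOneFaceOn.exists_union_oddEdge {o : G.Dart → α} (ho : G.IsOrigin o) {C : Set α}
    {S : Set β} {ρ : Perm G.MarkedDart} (h : IsOneFaceOn o C S ρ) {K : Graph α β}
    (hK : K.IsFinite) {e₁ : β} (hodd : K.IsOddEdge e₁)
    (hKG : ∀ e x y, K.IsLink e x y → e ≠ e₁ → G.IsLink e x y) (hS : Disjoint S E(K)) {r : α}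
    (hr : r ∈ V(K)) (hrC : r ∈ C) (hC : ∀ v ∈ V(K), v ∈ C → v = r) :
    ∃ ρ' : Perm G.MarkedDart, IsOneFaceOn o (C ∪ V(K)) (S ∪ (E(K) \ {e₁})) ρ' := by
  obtain ⟨T, ⟨⟨hTK, hT⟩, -⟩, hTodd⟩ := hodd
  have hV : V(T) = V(K) := hTK.vertexSet_eq
  have hle : T ≤ K := hTK.le
  have hHfin : (K.cotree T).IsFinite := ⟨hK.1, hK.2.sdiff⟩
  obtain ⟨he₁, k, hk, hkeven⟩ := exists_even_orientation hHfin hTodd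
  have hE : E(K.cotree T) = E(K) \ E(T) := rfl
  have hlink : ∀ e x y, K.IsLink e x y → e ∉ E(T) → (K.cotree T).IsLink e x y := by
    intro e x y h he
    rw [cotree, deleteEdges_isLink]
    exact ⟨h, he⟩
  have hinc : ∀ e x, (K.cotree T).Inc e x → K.Inc e x := by
    intro e x h
    exact h.mono deleteEdges_le
  rw [hE] at he₁ hk hkeven
  -- The edge e₁ belongs to the cotree, so T survives its deletion.
  have hTlink : ∀ e x y, T.IsLink e x y → G.IsLink e x y := by
    intro e x y h
    refine hKG e x y (h.mono hle) ?_
    rintro rfl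
    exact he₁.2 h.edge_mem
  obtain ⟨ρ₁, hρ₁⟩ := h.exists_union_tree ho hT (hV ▸ hK.1) hTlink (hV ▸ hr) hrC
    (fun v hv => hC v (hV ▸ hv))
  rw [hV] at hρ₁
  have hincG : ∀ e x, K.Inc e x → e ≠ e₁ → G.Inc e x := by
    rintro e x ⟨y, hy⟩ hne
    exact ⟨y, hKG e x y hy hne⟩
  obtain ⟨ρ₂, hρ₂⟩ := hρ₁.exists_union_pairs ho k ((E(K) \ E(T)) \ {e₁}) hK.2.sdiff.sdiff
    (fun e he => hincG e _ (hinc _ _ (hk e he.1)) he.2) (by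
      rintro e ⟨⟨he, -⟩, hne⟩ x hx
      obtain ⟨u, v, huv⟩ := exists_isLink_of_mem_edgeSet he
      rcases hx.eq_or_eq_of_isLink (hKG e u v huv hne) with rfl | rfl
      · exact Or.inr huv.left_mem
      · exact Or.inr huv.right_mem) hkeven (by
      rw [Set.disjoint_left]
      rintro e ⟨⟨he, he'⟩, -⟩ (h | h)
      · exact Set.disjoint_left.1 hS h he
      · exact he' h)
  refine ⟨ρ₂, ?_⟩
  have : S ∪ E(T) ∪ (E(K) \ E(T)) \ {e₁} = S ∪ (E(K) \ {e₁}) := by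
    have hsub := IsSubgraph.edgeSet_mono hle
    ext e
    simp only [Set.mem_union, Set.mem_sdiff, Set.mem_singleton_iff]
    constructor
    · rintro ((h | h) | h)
      · exact Or.inl h
      · refine Or.inr ⟨hsub h, ?_⟩
        rintro rfl
        exact he₁.2 h
      · exact Or.inr ⟨h.1.1, h.2⟩
    · tauto
  rwa [this] at hρ₂

omit [DecidableEq G.MarkedDart] in
/-- Removal of the markers. -/
theorem exists_rotationSystem_of_isRotationOn {o : G.Dart → α} (ho : G.IsOrigin o)
    {ρ : Perm G.MarkedDart} (hρ : IsRotationOn (markedOrg o) Set.univ ρ) (p q : G.MarkedDart)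
    (hpq : ∀ y, (ρ * G.markedRev).SameCycle y p ∨ (ρ * G.markedRev).SameCycle y q) :
    ∃ R : G.RotationSystem, Nat.card (Quotient (SameCycle.setoid R.facePerm)) ≤ 2 := by
  classical
  have hsc : ∀ y y', ρ.SameCycle y y' ↔ markedOrg o y = markedOrg o y' :=
    fun y y' => hρ.sameCycle_iff y trivial y' trivial
  obtain ⟨R, hR⟩ := exists_rotationSystem (A := G) ρ (markedOrg o) Sum.inl Sum.inl_injective
    (fun e => ho e false) (fun d d' => hsc _ _)
  have hface : ∀ a b, (ρ * G.markedRev).SameCycle (Sum.inl a) (Sum.inl b) →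
      R.facePerm.SameCycle a b := by
    intro a b hab
    obtain ⟨k, hk⟩ := hab.exists_nat_pow_eq
    clear hab
    induction k using Nat.strong_induction_on generalizing a with
    | _ k ih =>
      have hstep : ∀ y, (ρ * G.markedRev) y = ρ (G.markedRev y) := fun y => rfl
      rcases k with _ | k
      · rw [Sum.inl_injective (by simpa using hk : (Sum.inl a : G.MarkedDart) = Sum.inl b)]
      · rw [pow_succ, Perm.mul_apply, hstep, markedRev_inl] at hk
        rcases hcase : ρ (Sum.inl (a.1, !a.2)) with c | v
        · have hc : R.facePerm a = c := hR _ _ 0 hcase (by simp)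
          rw [hcase] at hk
          rw [← sameCycle_apply_left, hc]
          exact ih k (by omega) c hk
        · rw [hcase] at hk
          rcases k with _ | k
          · simp at hk
          · rw [pow_succ, Perm.mul_apply, hstep, markedRev_inr] at hk
            rcases hcase' : ρ (Sum.inr v) with c | v'
            · have hc : R.facePerm a = c := by
                -- Here the first return takes two steps, the marker being skipped.
                refine hR _ _ 1 ?_ ?_
                · rw [pow_succ, pow_one, Perm.mul_apply]
                  erw [hcase]
                  exact hcase'
                · intro j hj
                  obtain rfl : j = 0 := by omega
                  rw [zero_add, pow_one]
                  erw [hcase]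
                  simp
              rw [hcase'] at hk
              rw [← sameCycle_apply_left, hc]
              exact ih k (by omega) c hk
            -- Each vertex has only one marker, so two markers in succession would be a fixed point
            -- of ρ, although a dart has just been sent to that marker.
            · exfalso
              have h1 := (hρ.apply_mem (y := Sum.inr v) trivial).2
              rw [hcase'] at h1
              have h2 : v' = v := Subtype.ext h1
              rw [h2] at hcase'
              have := ρ.injective (hcase.trans hcase'.symm)
              simp at this
  refine ⟨R, ?_⟩
  -- Darts in the same marked face stay in the same face without markers, so a face is determined by
  -- whether it belongs to the marked face of p.
  let f : Quotient (SameCycle.setoid R.facePerm) → Bool := fun t =>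
    decide ((ρ * G.markedRev).SameCycle (Sum.inl t.out) p)
  have hf : Function.Injective f := by
    intro s t hst
    have hiff : (ρ * G.markedRev).SameCycle (Sum.inl s.out) p ↔
        (ρ * G.markedRev).SameCycle (Sum.inl t.out) p := by simpa [f] using hst
    rw [← Quotient.out_equiv_out]
    refine hface _ _ ?_
    by_cases hs : (ρ * G.markedRev).SameCycle (Sum.inl s.out) p
    · exact hs.trans (hiff.1 hs).symm
    · exact ((hpq _).resolve_left hs).trans ((hpq _).resolve_left (mt hiff.2 hs)).symm
  simpa using Nat.card_le_card_of_injective f hf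

-- From a₁ the one-face embedding grows over G₁ − e₁, crosses f₁ to the new vertex a₂, and grows
-- over G₂ − e₂. The last edge f₂ closes up and splits the face into two.
omit [DecidableEq G.MarkedDart] [Finite G.MarkedDart] in
theorem TwoSumData.exists_rotationSystem {G₁ G₂ : Graph α β} {e₁ e₂ f₁ f₂ : β} {a₁ b₁ a₂ b₂ : α}
    (D : TwoSumData G G₁ G₂ e₁ e₂ f₁ f₂ a₁ b₁ a₂ b₂) (h₁ : G₁.IsFinite) (h₂ : G₂.IsFinite)
    (ho₁ : G₁.IsOddEdge e₁) (ho₂ : G₂.IsOddEdge e₂) :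
    ∃ R : G.RotationSystem, Nat.card (Quotient (SameCycle.setoid R.facePerm)) ≤ 2 := by
  classical
  have := (D.isFinite h₁ h₂).finite_markedDart
  obtain ⟨o, ho⟩ := G.exists_isOrigin
  have ha₁ := D.link₁.left_mem
  have ha₂ := D.link₂.left_mem
  obtain ⟨ρ₁, hρ₁⟩ := (IsOneFaceOn.singleton o a₁).exists_union_oddEdge ho h₁ ho₁
    (fun e x y h hne => D.isLink_of_left h hne) (by simp) ha₁ rfl (fun v _ hv => hv)
  rw [Set.union_eq_self_of_subset_left (by simpa using ha₁), Set.empty_union] at hρ₁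
  obtain ⟨ρ₂, hρ₂⟩ := hρ₁.exists_insert_leaf ho D.isLink_f₁ ha₁ (D.notMem_left ha₂)
  obtain ⟨ρ₃, hρ₃⟩ := hρ₂.exists_union_oddEdge ho h₂ ho₂
    (fun e x y h hne => D.isLink_of_right h hne) (by
      rw [Set.disjoint_left]
      rintro e (rfl | ⟨he, -⟩) he₂
      · exact D.f₁_notMem (Or.inr he₂)
      · exact Set.disjoint_left.1 D.disjE he he₂) ha₂ (Set.mem_insert _ _) (by
      rintro v hv (rfl | hv')
      · rfl
      · exact absurd hv (D.notMem_right hv'))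
  obtain ⟨b, hb1, hb2⟩ := ho.exists_eq (e := ⟨f₂, D.isLink_f₂.edge_mem⟩) D.isLink_f₂
  have hf₂ : f₂ ∉ insert f₁ (E(G₁) \ {e₁}) ∪ E(G₂) \ {e₂} := by
    rintro ((h | ⟨h, -⟩) | ⟨h, -⟩)
    · exact D.f_ne h.symm
    · exact D.f₂_notMem (Or.inl h)
    · exact D.f₂_notMem (Or.inr h)
  have hCV : ∀ x ∈ V(G), x ∈ insert a₂ V(G₁) ∪ V(G₂) := by
    intro x hx
    rw [D.vertexSet_eq] at hx
    rcases hx with hx | hx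
    · exact Or.inl (Or.inr hx)
    · exact Or.inr hx
  obtain ⟨ρ₄, hrot, -, -, hcover⟩ := hρ₃.insert_edge (e := ⟨f₂, D.isLink_f₂.edge_mem⟩) (b := b)
    ho.mem hf₂ (hCV _ (ho.mem _)) (hCV _ (ho.mem _))
  have huniv : G.markedZone (insert f₂ (insert f₁ (E(G₁) \ {e₁}) ∪ E(G₂) \ {e₂})) = Set.univ := by
    refine Set.eq_univ_of_forall fun y d hy => ?_
    have hd := (Set.ext_iff.1 D.edgeSet_eq _).1 d.1.2
    rcases hd with (h | h) | (h | h)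
    · exact Or.inr (Or.inl (Or.inr h))
    · exact Or.inr (Or.inr h)
    · exact Or.inr (Or.inl (Or.inl h))
    · exact Or.inl h
  refine exists_rotationSystem_of_isRotationOn ho (huniv ▸ hrot) _ _ fun y =>
    hcover y (huniv ▸ trivial) (hCV _ ?_)
  rcases y with d | v
  · exact ho.mem d
  · exact v.2

/-- The Xuong tree witnessing that e₁ is odd spans K and does not contain e₁. -/
theorem IsOddEdge.reachable_deleteEdges {K : Graph α β} {e₁ : β} (h : K.IsOddEdge e₁) :
    ∀ x ∈ V(K), ∀ y ∈ V(K), (K.deleteEdges {e₁}).Reachable x y := by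
  obtain ⟨T, ⟨⟨hTK, hT⟩, -⟩, hTodd⟩ := h
  have he₁ : e₁ ∉ E(T) := by
    obtain ⟨x, hx, hxe, -⟩ : {e₁} ∈ (K.cotree T).oddComponents := hTodd ▸ rfl
    obtain ⟨y, -, hy⟩ : e₁ ∈ (K.cotree T).componentEdges x := hxe ▸ rfl
    rw [cotree, deleteEdges_inc] at hy
    exact hy.2
  intro x hx y hy
  refine (hT.1.2 x (hTK.vertexSet_eq ▸ hx) y (hTK.vertexSet_eq ▸ hy)).mono fun e u v huv => ?_
  rw [deleteEdges_isLink]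
  refine ⟨huv.mono hTK.le, ?_⟩
  rintro rfl
  exact he₁ huv.edge_mem

end Graph

/-! ### The theorem -/

theorem theorem7p4 {α : Type*} {β : Type*} (G₁ G₂ G : Graph α β) (e₁ e₂ : β)
    (h₁ : G₁.IsTwoConnected) (ht₁ : G₁.IsTightlyTwoFaceEmbeddable)
    (h₂ : G₂.IsTwoConnected) (ht₂ : G₂.IsTightlyTwoFaceEmbeddable)
    (hG : G.IsOddTwoSum G₁ G₂ e₁ e₂) :
    G.IsTwoConnected ∧ G.IsTightlyTwoFaceEmbeddable := by
  obtain ⟨ho₁, ho₂, hV, hE, f₁, f₂, a₁, b₁, a₂, b₂, hf, hf₁, hf₂, hl₁, hne₁, hl₂, hne₂, hVG, hlink⟩ :=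
    hG
  have D : Graph.TwoSumData G G₁ G₂ e₁ e₂ f₁ f₂ a₁ b₁ a₂ b₂ :=
    ⟨hV, hE, hf, hf₁, hf₂, hl₁, hne₁, hl₂, hne₂, hVG, hlink⟩
  obtain ⟨c₁, ⟨hconn₁, R₁, hR₁⟩, hn₁⟩ := ht₁
  obtain ⟨c₂, ⟨hconn₂, R₂, hR₂⟩, hn₂⟩ := ht₂
  have hcub := D.isCubic c₁ c₂ (h₁.loopless c₁) (h₂.loopless c₂)
  have htwo := D.isTwoConnected h₁ h₂ (h₁.loopless c₁) (h₂.loopless c₂) ho₁.reachable_deleteEdges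
    ho₂.reachable_deleteEdges
  have hev₁ : Even (G₁.vertexSet.ncard + G₁.edgeSet.ncard) := by
    have := R₁.even_faceCount_add c₁.1
    rw [hR₁] at this
    exact (Nat.even_add.1 this).1 even_two
  have hev₂ : Even (G₂.vertexSet.ncard + G₂.edgeSet.ncard) := by
    have := R₂.even_faceCount_add c₂.1
    rw [hR₂] at this
    exact (Nat.even_add.1 this).1 even_two
  refine ⟨htwo, hcub, ⟨htwo.1, ?_⟩, ?_⟩
  · obtain ⟨R, hR⟩ := D.exists_rotationSystem c₁.1 c₂.1 ho₁ ho₂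
    refine ⟨R, ?_⟩
    -- The number of faces is positive, at most two, and even by parity; hence it is two.
    have h3 := R.faceCount_le htwo.1 (by norm_num) hR
    have h4 := R.faceCount_pos hcub.1 htwo.1.1
    have h5 := R.even_faceCount_add hcub.1
    have h6 := D.ncard_vertexSet c₁.1 c₂.1
    have h7 := D.ncard_edgeSet c₁.1 c₂.1
    obtain ⟨p, hp⟩ := hev₁
    obtain ⟨q, hq⟩ := hev₂
    obtain ⟨r, hr⟩ := h5
    omega
  · rintro ⟨-, -, x, y, hxy⟩
    exact D.not_isRemovablePair c₁ c₂ h₁ h₂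
      (fun x y h => hn₁ ⟨c₁, ⟨hconn₁, R₁, hR₁⟩, x, y, h⟩)
      (fun x y h => hn₂ ⟨c₂, ⟨hconn₂, R₂, hR₂⟩, x, y, h⟩) hev₁ hev₂ x y hxy
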